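/- **Setting.** Let $\Gamma$ be the circle $S^1=[0,1]/(0\sim1)$ or a closed interval $[a,b]$, $0\le a<b$. An exchange transformation of $n$ subintervals with $f$ flips (an $n$-CET if $\Gamma=S^1$, an $n$-IET if $\Gamma=[a,b]$) is an injective map $T:\bigcup_{i=1}^nI_i\to\Gamma$, where $I_1,\dots,I_n$ are pairwise disjoint nonempty intervals, open in $\Gamma$, whose union is dense in $\Gamma$, such that $T$ is an isometry on each $I_i$, reverses the orientation of exactly $f$ of the $I_i$, and has no continuous extension to a larger open subset of $\Gamma$. The orbit of $p\in\Gamma$ is $\{T^n(p): n\in\mathbb Z,\ p\in\mathrm{Dom}(T^n)\}$. $T$ is transitive if some orbit is dense, minimal if it is transitive and has no finite orbit, and uniquely ergodic if Lebesgue measure is, up to scalar multiples, the only finite Borel measure $\nu$ on $\Gamma$ that is invariant, i.e. $\nu(T(A))=\nu(A)$ for all Borel $A\subset\mathrm{Dom}(T)$. $\mathcal I(n,f)$ and $\mathcal C(n,f)$ are the sets of transitive $n$-IETs and $n$-CETs with $f$ flips. A signed permutation is a tuple $p=(\theta_1\pi_1,\dots,\theta_n\pi_n)$ with $\theta_i=\pm1$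 and $\pi$ a permutation of $\{1,\dots,n\}$; it is irreducible if $\pi(\{1,\dots,k\})=\{1,\dots,k\}$ with $1\le k\le n$ only for $k=n$. For $\lambda_i>0$, $\mathcal E(\lambda,p)$ is the IET of $[0,\sum_i\lambda_i]$ that divides it into consecutive intervals of lengths $\lambda_1,\dots,\lambda_n$ and carries the $i$-th isometrically onto the $\pi_i$-th interval of the image partition, reversing orientation iff $\theta_i=-1$. Let $k=\pi^{-1}(n)$, let $E$ be the identity matrix and $E_{ij}$ the matrix units. The transition maps $a,b$ on signed permutations are: * $a(p)_i=\theta_i\pi_i$ if $\pi_i\le\pi_n$ (when $\theta_n=1$) or $\pi_i\le\pi_n-1$ (when $\theta_n=-1$); otherwise, if $\pi_i=n$, $a(p)_i=\theta_i(\pi_n+1)$ (when $\theta_n=1$) or $-\theta_i\pi_n$ (when $\theta_n=-1$); otherwise $a(p)_i=\theta_i(\pi_i+1)$. * If $\theta_k=1$: $b(p)_i=p_i$ for $i\le k$, $b(p)_{k+1}=p_n$, $b(p)_i=p_{i-1}$ for $i>k+1$. If $\theta_k=-1$: $b(p)_i=p_i$ for $i<k$, $b(p)_k=-p_n$, $b(p)_i=p_{i-1}$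 for $i>k$. The transition matrices are $M_a(p)=E+E_{n,k}$ and $M_b(p)=\sum_{i=1}^{k}E_{i,i}+E_{n,s}+\sum_{i=k}^{n-1}E_{i,i+1}$ with $s=k+(1+\theta_k)/2$. A Rauzy path is a sequence $p^{(0)},\dots,p^{(N)}$ ($N\ge1$) of irreducible signed permutations with $p^{(i)}=t_i(p^{(i-1)})$, $t_i\in\{a,b\}$; it has type itinerary $t_1\dots t_N$ and product matrices $M^{(i)}=M_{t_1}(p^{(0)})\cdots M_{t_i}(p^{(i-1)})$. It is a special cycle if $p^{(N)}=p^{(0)}$ and some positive power of $M^{(N)}$ has only positive entries. **Theorem.** The path $\gamma_1$ from $p^{(0)}=(-3,+4,+1,-2)$ with type itinerary $a,b,a,b,b,a,b,a,b$ is a special cycle, and the path $\gamma_2$ from $q^{(0)}=(-3,-1,-4,-2)$ with type itinerary $a,b,b,a$ is a Rauzy path that ends on it: $q^{(4)}=p^{(5)}=(+4,-3,+1,-2)$. The matrix $M=M^{(9)}_{\gamma_1}$ has a positive eigenvalue $\sigma$ of maximum modulus with an eigenvector $\lambda$ with positive coordinates of sum $1$ such that, for $\mu=M^{(4)}_{\gamma_2}\bigl(M^{(5)}_{\gamma_1}\bigr)^{-1}\lambda$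 and $|\mu|=\sum_i\mu_i$, the following holds. $T=\mathcal E(\mu/|\mu|,q^{(0)})$ is a minimal, uniquely ergodic $4$-IET of $[0,1]$ with four flips, and identifying the endpoints of $[0,1]$ turns $T$ into a minimal, uniquely ergodic $3$-CET with three flips. In particular $\mathcal I(4,4)\ne\emptyset$ and $\mathcal C(3,3)\ne\emptyset$. -/

import Mathlib

namespace ExchangeMaps

/-! ### Partially defined self-maps, orbits, minimality, unique ergodicity -/

/-- A partially defined self-map of `Γ`: only the values of `toFun` on `dom` are meaningful. -/
structure PartialSelfMap (Γ : Type*) where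
  toFun : Γ → Γ
  dom : Set Γ

namespace PartialSelfMap

variable {Γ : Type*}

/-- The domain of the `n`-th iterate, `n ≥ 0`. -/
def iterDom (T : PartialSelfMap Γ) (n : ℕ) : Set Γ :=
  {x | ∀ k < n, T.toFun^[k] x ∈ T.dom}

/-- The full orbit `{T^n p | n ∈ ℤ, p ∈ Dom (T^n)}` of `p` under an injective partial map;
`q = T^(-n) p` means `T^n q = p`. -/
def orbit (T : PartialSelfMap Γ) (p : Γ) : Set Γ :=
  {q | ∃ n : ℕ, (p ∈ T.iterDom n ∧ T.toFun^[n] p = q) ∨ (q ∈ T.iterDom n ∧ T.toFun^[n] q = p)}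

/-- Some orbit is dense. -/
def IsTransitive [TopologicalSpace Γ] (T : PartialSelfMap Γ) : Prop :=
  ∃ p, Dense (T.orbit p)

/-- Transitive, and without finite orbits. -/
def IsMinimal [TopologicalSpace Γ] (T : PartialSelfMap Γ) : Prop :=
  T.IsTransitive ∧ ∀ p, (T.orbit p).Infinite

/-- The measure `μ` is invariant under the injective partial map `T`. -/
def IsInvariant [MeasurableSpace Γ] (T : PartialSelfMap Γ) (μ : MeasureTheory.Measure Γ) : Prop :=
  ∀ A : Set Γ, MeasurableSet A → A ⊆ T.dom → μ (T.toFun '' A) = μ A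

/-- Lebesgue measure is invariant, and every finite invariant Borel measure is a multiple of it. -/
def IsUniquelyErgodic [MeasureTheory.MeasureSpace Γ] (T : PartialSelfMap Γ) : Prop :=
  T.IsInvariant MeasureTheory.volume ∧
    ∀ μ : MeasureTheory.Measure Γ, MeasureTheory.IsFiniteMeasure μ → T.IsInvariant μ →
      ∃ c : ENNReal, μ = c • MeasureTheory.volume

/-- `T` has no continuous extension to an open set strictly larger than its domain. -/
def IsMaximal [TopologicalSpace Γ] (T : PartialSelfMap Γ) : Prop :=
  ∀ U : Set Γ, IsOpen U → T.dom ⊂ U →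
    ¬ ∃ g : Γ → Γ, ContinuousOn g U ∧ Set.EqOn g T.toFun T.dom

/-- Exchange map of `n` open subintervals with `f` flips. The parameters say which subsets of `Γ`
are open intervals, and when a map acts on such a set as an orientation preserving, respectively
orientation reversing, isometry. -/
def IsExchange [TopologicalSpace Γ] (isOpenInterval : Set Γ → Prop)
    (preserves reverses : (Γ → Γ) → Set Γ → Prop) (n f : ℕ) (T : PartialSelfMap Γ) : Prop :=
  ∃ I : Fin n → Set Γ,
    (∀ i, isOpenInterval (I i)) ∧
    (∀ i j, i ≠ j → Disjoint (I i) (I j)) ∧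
    T.dom = ⋃ i, I i ∧
    closure (⋃ i, I i) = Set.univ ∧
    Set.InjOn T.toFun T.dom ∧
    (∀ i, preserves T.toFun (I i) ∨ reverses T.toFun (I i)) ∧
    {i | reverses T.toFun (I i)}.ncard = f ∧
    T.IsMaximal

end PartialSelfMap

/-! ### Interval exchange transformations of `[a, b]` -/

/-- `T` is an interval exchange transformation of `[a, b]`, `0 ≤ a < b`, of `n` subintervals
(open in `[a, b]`) with `f` flips. -/
def IsIET {a b : ℝ} (n f : ℕ) (T : PartialSelfMap (Set.Icc a b)) : Prop :=
  0 ≤ a ∧ a < b ∧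
    T.IsExchange
      (fun I => IsOpen I ∧ I.OrdConnected ∧ I.Nonempty)
      (fun F I => StrictMonoOn F I ∧ ∀ x ∈ I, ∀ y ∈ I, dist (F x) (F y) = dist x y)
      (fun F I => StrictAntiOn F I ∧ ∀ x ∈ I, ∀ y ∈ I, dist (F x) (F y) = dist x y)
      n f

/-- The set `I(n, f)` of transitive interval exchange transformations (on any `[a, b]`,
`0 ≤ a < b`) of `n` subintervals with `f` flips. -/
def transitiveIETs (n f : ℕ) : Set (Σ r : ℝ × ℝ, PartialSelfMap (Set.Icc r.1 r.2)) :=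
  {T | IsIET n f T.2 ∧ T.2.IsTransitive}

/-! ### Circle exchange transformations of `S¹ = ℝ / ℤ` -/

/-- `T` is a circle exchange transformation of `n` subintervals with `f` flips. The orientation
preserving (reversing) isometries of an arc into the circle are the restrictions of the maps
`x ↦ x + c` (of the maps `x ↦ c - x`). -/
def IsCET (n f : ℕ) (T : PartialSelfMap UnitAddCircle) : Prop :=
  T.IsExchange
    (fun I => ∃ u v : ℝ, u < v ∧ v ≤ u + 1 ∧ I = (fun x : ℝ => (x : UnitAddCircle)) '' Set.Ioo u v)
    (fun F I => ∃ c : UnitAddCircle, ∀ x ∈ I, F x = x + c)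
    (fun F I => ∃ c : UnitAddCircle, ∀ x ∈ I, F x = c - x)
    n f

/-- The set `C(n, f)` of transitive circle exchange transformations of `n` subintervals with
`f` flips. -/
def transitiveCETs (n f : ℕ) : Set (PartialSelfMap UnitAddCircle) :=
  {T | IsCET n f T ∧ T.IsTransitive}

/-- `S` extends the map that `T` induces on the circle `[0, 1] / (0 ∼ 1)`. (Together with `IsCET`,
whose domain is maximal, this determines `S`.) -/
def IsEndpointIdentification (T : PartialSelfMap (Set.Icc (0 : ℝ) 1))
    (S : PartialSelfMap UnitAddCircle) : Prop :=
  ∀ x : Set.Icc (0 : ℝ) 1, x ∈ T.dom → 0 < (x : ℝ) → (x : ℝ) < 1 →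
    ((x : ℝ) : UnitAddCircle) ∈ S.dom ∧
      S.toFun ((x : ℝ) : UnitAddCircle) = ((T.toFun x : ℝ) : UnitAddCircle)

/-! ### Signed permutations and the coordinates of an interval exchange transformation -/

/-- `p` is the tuple `(θ₁ π(1), …, θₙ π(n))` of an irreducible signed permutation of `{1, …, n}`;
positions are indexed by `0, …, n - 1`, entries are the usual `±1, …, ±n`. -/
def IsIrreducibleSigned {n : ℕ} (p : Fin n → ℤ) : Prop :=
  ∃ (π : Equiv.Perm (Fin n)) (θ : Fin n → ℤˣ),
    (∀ i, p i = (θ i : ℤ) * (((π i : ℕ) : ℤ) + 1)) ∧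
    ∀ k : ℕ, 1 ≤ k → k ≤ n →
      π '' {i : Fin n | (i : ℕ) < k} = {i : Fin n | (i : ℕ) < k} → k = n

/-- `T` acts as `E(l, p)`: the interval `[0, ℓ]` is cut from left to right into subintervals of
lengths `l i > 0`, the `i`-th of which is carried isometrically onto the `|p i|`-th interval of the
image partition, preserving orientation if `p i > 0` and reversing it if `p i < 0`. (Together with
`IsIET`, whose domain is maximal, this determines `T`.) -/
def HasCoordinates {n : ℕ} {ℓ : ℝ} (T : PartialSelfMap (Set.Icc (0 : ℝ) ℓ))
    (l : Fin n → ℝ) (p : Fin n → ℤ) : Prop :=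
  (∀ i, 0 < l i) ∧ ∑ i, l i = ℓ ∧
    ∀ i, ∀ x : Set.Icc (0 : ℝ) ℓ,
      let left : ℝ := ∑ j with j < i, l j
      let imageLeft : ℝ := ∑ j with |p j| < |p i|, l j
      left < (x : ℝ) → (x : ℝ) < left + l i →
        x ∈ T.dom ∧
        (T.toFun x : ℝ) =
          if 0 < p i then imageLeft + ((x : ℝ) - left)
          else imageLeft + l i - ((x : ℝ) - left)

/-! ### The Rauzy graph: transition maps, transition matrices, paths -/

/-- The two types of edges of the Rauzy graph. -/
inductive RauzyType
  | a
  | b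

section Rauzy

variable {m : ℕ}

/-- The position `π⁻¹(n)` of the entry `±n`, where `n = m + 1`. -/
def topIndex (p : Fin (m + 1) → ℤ) : Fin (m + 1) :=
  ((List.finRange (m + 1)).find? fun i => |p i| = (m : ℤ) + 1).getD (Fin.last m)

/-- The transition map `a`. -/
def moveA (p : Fin (m + 1) → ℤ) : Fin (m + 1) → ℤ := fun i =>
  let θi : ℤ := (p i).sign
  let πn : ℤ := |p (Fin.last m)|
  if 0 < p (Fin.last m) then
    if |p i| ≤ πn then p i
    else if |p i| = (m : ℤ) + 1 then θi * (πn + 1)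
    else θi * (|p i| + 1)
  else
    if |p i| ≤ πn - 1 then p i
    else if |p i| = (m : ℤ) + 1 then -θi * πn
    else θi * (|p i| + 1)

/-- The transition map `b`. -/
def moveB (p : Fin (m + 1) → ℤ) : Fin (m + 1) → ℤ := fun i =>
  let k := topIndex p
  if 0 < p k then
    if i ≤ k then p i
    else if (i : ℕ) = k + 1 then p (Fin.last m)
    else p ⟨i - 1, by omega⟩
  else
    if i < k then p i
    else if i = k then -p (Fin.last m)
    else p ⟨i - 1, by omega⟩

/-- The transition maps. -/
def move : RauzyType → (Fin (m + 1) → ℤ) → (Fin (m + 1) → ℤ)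
  | .a => moveA
  | .b => moveB

/-- The transition matrix `M_a = E + E_{n, π⁻¹(n)}`. -/
def matA (p : Fin (m + 1) → ℤ) : Matrix (Fin (m + 1)) (Fin (m + 1)) ℤ :=
  1 + Matrix.of fun i j => if i = Fin.last m ∧ j = topIndex p then 1 else 0

/-- The transition matrix `M_b = ∑_{i ≤ k} E_{i,i} + E_{n,s} + ∑_{k ≤ i < n} E_{i,i+1}`, where
`k = π⁻¹(n)` and `s = k + (1 + θ_k) / 2`. -/
def matB (p : Fin (m + 1) → ℤ) : Matrix (Fin (m + 1)) (Fin (m + 1)) ℤ :=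
  Matrix.of fun i j =>
    let k := topIndex p
    let s : ℕ := if 0 < p k then k + 1 else k
    (if i ≤ k ∧ j = i then 1 else 0) +
    (if i = Fin.last m ∧ (j : ℕ) = s then 1 else 0) +
    (if k ≤ i ∧ (j : ℕ) = i + 1 then 1 else 0)

/-- The transition matrices. -/
def mat : RauzyType → (Fin (m + 1) → ℤ) → Matrix (Fin (m + 1)) (Fin (m + 1)) ℤ
  | .a => matA
  | .b => matB

/-- The last vertex of the path that starts at `p` and has type itinerary `w`. -/
def pathEnd : List RauzyType → (Fin (m + 1) → ℤ) → (Fin (m + 1) → ℤ)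
  | [], p => p
  | t :: w, p => pathEnd w (move t p)

/-- The product `M_{t₁}(p⁽⁰⁾) M_{t₂}(p⁽¹⁾) ⋯ M_{t_N}(p⁽ᴺ⁻¹⁾)` of the transition matrices along the
path that starts at `p` and has type itinerary `w`. -/
def pathMatrix : List RauzyType → (Fin (m + 1) → ℤ) → Matrix (Fin (m + 1)) (Fin (m + 1)) ℤ
  | [], _ => 1
  | t :: w, p => mat t p * pathMatrix w (move t p)

/-- The type itinerary `w` and the start `p` define a path of positive length in the Rauzy graph,
whose vertices are the irreducible signed permutations. -/
def IsRauzyPath (w : List RauzyType) (p : Fin (m + 1) → ℤ) : Prop :=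
  w ≠ [] ∧ ∀ k ≤ w.length, IsIrreducibleSigned (pathEnd (w.take k) p)

/-- Some positive power of `A` has only positive entries. -/
def IsEventuallyPositive (A : Matrix (Fin (m + 1)) (Fin (m + 1)) ℤ) : Prop :=
  ∃ k : ℕ, 0 < k ∧ ∀ i j, 0 < (A ^ k) i j

/-- A cycle of the Rauzy graph with eventually positive product matrix. -/
def IsSpecialCycle (w : List RauzyType) (p : Fin (m + 1) → ℤ) : Prop :=
  IsRauzyPath w p ∧ pathEnd w p = p ∧ IsEventuallyPositive (pathMatrix w p)

/-- An integer matrix regarded as a real matrix. -/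
def toReal (A : Matrix (Fin (m + 1)) (Fin (m + 1)) ℤ) : Matrix (Fin (m + 1)) (Fin (m + 1)) ℝ :=
  A.map (fun z : ℤ => (z : ℝ))

/-- `σ > 0` is an eigenvalue of `A` of maximum modulus, and `l` is a corresponding eigenvector with
positive coordinates of sum `1`. -/
def IsPerronFrobenius (A : Matrix (Fin (m + 1)) (Fin (m + 1)) ℤ) (σ : ℝ)
    (l : Fin (m + 1) → ℝ) : Prop :=
  0 < σ ∧ (∀ i, 0 < l i) ∧ ∑ i, l i = 1 ∧ (toReal A).mulVec l = σ • l ∧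
    ∀ (z : ℂ) (v : Fin (m + 1) → ℂ), v ≠ 0 →
      (A.map (fun k : ℤ => (k : ℂ))).mulVec v = z • v → ‖z‖ ≤ σ

end Rauzy

/-- Start `(-3, +4, +1, -2)` of the special cycle. -/
def cycleStart : Fin 4 → ℤ := ![-3, 4, 1, -2]

/-- Type itinerary of the special cycle. -/
def cycleTypes : List RauzyType := [.a, .b, .a, .b, .b, .a, .b, .a, .b]

/-- Start `(-3, -1, -4, -2)` of the path that ends on the special cycle. -/
def tailStart : Fin 4 → ℤ := ![-3, -1, -4, -2]

/-- Type itinerary of the path that ends on the special cycle. -/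
def tailTypes : List RauzyType := [.a, .b, .b, .a]

end ExchangeMaps

/-!
The combinatorial claims concern thirteen signed permutations and are checked by evaluation. The
dynamical claims rest on Rauzy induction, used through two kinds of objects that live on the real
line and need no return maps.

*Functions.* The distribution function `F` of a measure without atoms that is invariant under `E(l,
p)` is monotone and equivariant: its increments over the intervals of the partition are carried
along by the branches (`IsEquivariant`). Equivariance passes to the induced exchange, and the
vector of increments over the intervals transforms by the transition matrix, as the lengths do
(`IsInduction.isEquivariant`, `IsInduction.increments_eq`). The special cycle induces a copy of the
exchange scaled by `1 / σ`, so the increments lie in the images of the positive cone under all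
powers of the cycle matrix; the matrix is eventually positive, and these images shrink to the ray
of the Perron–Frobenius eigenvector (`exists_eq_smul_of_forall_eq_mulVec`). Hence at all levels the
increments of `F` are proportional to the lengths. Subtracting the linear function leaves a
function that returns to the same value at all cuts, and whose oscillation between cuts is
controlled by the deepest level (`IsInduction.oscLE`); it is constant. So Lebesgue measure is the
only invariant measure without atoms (`IsSelfInducing.exists_eq_add_mul`, `exists_eq_smul_volume`).

*Saturated sets.* If an orbit contains a cut of the partition, it contains a cut of every induced
partition (`IsInduction.exists_leftEnd_mem`). The induced intervals shrink to `0`, so the orbit is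
infinite (`IsSelfInducing.infinite_of_leftEnd_mem`). This replaces the usual argument that there
are no saddle connections.

The two are combined in `PartialSelfMap.isMinimal_and_isUniquelyErgodic`. Lebesgue measure is
ergodic, as its restriction to a saturated set is again invariant without atoms; so almost every
orbit is dense. A periodic point would have a neighbourhood of periodic points, whose orbit could
be made small but not null, against ergodicity; so a finite orbit has to end at a cut, where orbits
are infinite. Without finite orbits no finite invariant measure has atoms.

All branches of `E(l, (-3, -1, -4, -2))` are reflections. At the cut between the second and the
third interval the one-sided limits are `0` and `1`; on the circle the two intervals merge, and the
properties of the circle map follow from those of the interval map via the quotient map.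
-/


namespace ExchangeMaps

/-! ### Rauzy induction as a relation between partitions -/

section Branches

variable {n : ℕ} {R : Type*} [AddCommGroup R]

/-- The left end of the `i`-th interval of the partition with lengths `l`. -/
def leftEnd (l : Fin n → R) (i : Fin n) : R := ∑ j with j < i, l j

/-- The right end of the `i`-th interval of the partition with lengths `l`. -/
def rightEnd (l : Fin n → R) (i : Fin n) : R := leftEnd l i + l i

/-- The left end of the image of the `i`-th interval under `E(l, p)`. -/
def imageLeftEnd (l : Fin n → R) (p : Fin n → ℤ) (i : Fin n) : R :=
  ∑ j with |p j| < |p i|, l j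

/-- The affine map that agrees with `E(l, p)` on the `i`-th interval. -/
def branch (l : Fin n → R) (p : Fin n → ℤ) (i : Fin n) (x : R) : R :=
  if 0 < p i then imageLeftEnd l p i + (x - leftEnd l i)
  else imageLeftEnd l p i + l i - (x - leftEnd l i)

lemma branch_eq (l : Fin n → R) (p : Fin n → ℤ) (i : Fin n) (x y : R) :
    branch l p i y = branch l p i x + if 0 < p i then y - x else x - y := by
  unfold branch
  split_ifs <;> abel

/-- The `j`-th interval of the partition `l'` is contained in the `i`-th interval of `l`. -/
def IsNested [LE R] (l l' : Fin n → R) (j i : Fin n) : Prop :=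
  leftEnd l i ≤ leftEnd l' j ∧ rightEnd l' j ≤ rightEnd l i

/-- `[u, v]` is the `j`-th interval of the partition `l'`, or its image under a branch of
`E(l, p)`. -/
def IsFloor [LE R] (l : Fin n → R) (p : Fin n → ℤ) (l' : Fin n → R) (j : Fin n) (u v : R) : Prop :=
  (u = leftEnd l' j ∧ v = rightEnd l' j) ∨
  ∃ i, IsNested l l' j i ∧
    ((0 < p i ∧ u = branch l p i (leftEnd l' j) ∧ v = branch l p i (rightEnd l' j)) ∨
     (¬ 0 < p i ∧ u = branch l p i (rightEnd l' j) ∧ v = branch l p i (leftEnd l' j)))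

/-- Each branch of `E(l', p')` is a branch of `E(l, p)` or a composition of two of them. -/
def BranchesCompose [LE R] (l : Fin n → R) (p : Fin n → ℤ) (l' : Fin n → R) (p' : Fin n → ℤ) :
    Prop :=
  ∀ j, (∃ i, IsNested l l' j i ∧ (0 < p' j ↔ 0 < p i) ∧
      branch l' p' j (leftEnd l' j) = branch l p i (leftEnd l' j)) ∨
    ∃ i k, IsNested l l' j i ∧ (0 < p' j ↔ (0 < p i ↔ 0 < p k)) ∧
      (leftEnd l k ≤ branch l p i (leftEnd l' j) ∧ branch l p i (leftEnd l' j) ≤ rightEnd l k) ∧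
      (leftEnd l k ≤ branch l p i (rightEnd l' j) ∧ branch l p i (rightEnd l' j) ≤ rightEnd l k) ∧
      branch l' p' j (leftEnd l' j) = branch l p k (branch l p i (leftEnd l' j))

/-- Each interval of the partition `l` is a floor, or is cut into two floors; the matrix `M`
records which. -/
def FloorsCover [LE R] (M : Matrix (Fin n) (Fin n) ℤ) (l : Fin n → R) (p : Fin n → ℤ)
    (l' : Fin n → R) : Prop :=
  ∀ i, (∃ j, M i = Pi.single j 1 ∧ IsFloor l p l' j (leftEnd l i) (rightEnd l i)) ∨
    ∃ j k, M i = Pi.single j 1 + Pi.single k 1 ∧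
      IsFloor l p l' j (leftEnd l i) (leftEnd l i + l' j) ∧
      IsFloor l p l' k (leftEnd l i + l' j) (rightEnd l i)

/-- Each interior end point of the partition `l` is an interior end point of `l'`, or the image of
one that is interior to an interval of `l`. -/
def EndsLift [PartialOrder R] (l : Fin n → R) (p : Fin n → ℤ) (l' : Fin n → R) : Prop :=
  ∀ i : Fin n, (i : ℕ) ≠ 0 → ∃ j : Fin n, (j : ℕ) ≠ 0 ∧ (leftEnd l i = leftEnd l' j ∨
    ∃ k, (leftEnd l k ≤ leftEnd l' j ∧ leftEnd l k ≠ leftEnd l' j) ∧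
      (leftEnd l' j ≤ rightEnd l k ∧ leftEnd l' j ≠ rightEnd l k) ∧
      branch l p k (leftEnd l' j) = leftEnd l i)

/-- `E(l', p')` is induced by `E(l, p)` on a shorter interval, with return times one and two, and
`M` counts the visits to the intervals of `l`. All conditions are linear relations between end
points of intervals, so that they make sense in any ordered group. -/
def IsInduction [PartialOrder R] (M : Matrix (Fin n) (Fin n) ℤ) (l : Fin n → R) (p : Fin n → ℤ)
    (l' : Fin n → R) (p' : Fin n → ℤ) : Prop :=
  BranchesCompose l p l' p' ∧ FloorsCover M l p l' ∧ EndsLift l p l'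

section Decidable

variable [DecidableEq R] (M : Matrix (Fin n) (Fin n) ℤ) (l : Fin n → R) (p : Fin n → ℤ)
  (l' : Fin n → R) (p' : Fin n → ℤ)

instance [LE R] [DecidableLE R] (j i : Fin n) : Decidable (IsNested l l' j i) :=
  inferInstanceAs (Decidable (_ ∧ _))

instance [LE R] [DecidableLE R] (j : Fin n) (u v : R) : Decidable (IsFloor l p l' j u v) :=
  inferInstanceAs (Decidable (_ ∨ _))

instance [LE R] [DecidableLE R] : Decidable (BranchesCompose l p l' p') :=
  inferInstanceAs (Decidable (∀ _, _))

instance [LE R] [DecidableLE R] : Decidable (FloorsCover M l p l') :=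
  @Fintype.decidableForallFintype _ _ (fun i => by
    have (f : Fin n → ℤ) : Decidable (M i = f) := inferInstanceAs (Decidable ((_ : Fin n → ℤ) = f))
    infer_instance) _

instance [PartialOrder R] [DecidableLE R] : Decidable (EndsLift l p l') :=
  inferInstanceAs (Decidable (∀ _, _))

instance instDecidableIsInduction [PartialOrder R] [DecidableLE R] :
    Decidable (IsInduction M l p l' p') :=
  inferInstanceAs (Decidable (_ ∧ _))

end Decidable

/-- The conditions of `IsInduction` for all positive lengths `l'` and `l = M l'`: the lengths are
replaced by their coordinate vectors with respect to `l'`. -/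
def IsFormalInduction (M : Matrix (Fin n) (Fin n) ℤ) (p p' : Fin n → ℤ) : Prop :=
  IsInduction (R := Fin n → ℤ) M M p (fun j => Pi.single j 1) p'

instance : DecidableLE (Fin n → ℤ) := fun a b => decidable_of_iff (∀ i, a i ≤ b i) Iff.rfl

noncomputable instance (M : Matrix (Fin n) (Fin n) ℤ) (p p' : Fin n → ℤ) :
    Decidable (IsFormalInduction M p p') :=
  instDecidableIsInduction (R := Fin n → ℤ) M M p (fun j => Pi.single j 1) p'

/-! ### Transport of the formal conditions to real lengths -/

/-- The real number with coordinate vector `v` with respect to the lengths `l`. -/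
def dotHom (l : Fin n → ℝ) : (Fin n → ℤ) →+ ℝ where
  toFun v := ∑ j, (v j : ℝ) * l j
  map_zero' := by simp
  map_add' v w := by simp [add_mul, Finset.sum_add_distrib]

lemma dotHom_single (l : Fin n → ℝ) (j : Fin n) : dotHom l (Pi.single j 1) = l j := by
  simp [dotHom, Pi.single_apply]

lemma dotHom_mono {l : Fin n → ℝ} (hl : ∀ i, 0 < l i) : Monotone (dotHom l) := by
  intro v w h
  change ∑ j, (v j : ℝ) * l j ≤ ∑ j, (w j : ℝ) * l j
  exact Finset.sum_le_sum fun j _ =>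
    mul_le_mul_of_nonneg_right (by exact_mod_cast h j) (hl j).le

lemma dotHom_injOn_le {l : Fin n → ℝ} (hl : ∀ i, 0 < l i) {v w : Fin n → ℤ} (h : v ≤ w)
    (hne : v ≠ w) : dotHom l v ≠ dotHom l w := by
  intro heq
  refine hne (funext fun j => ?_)
  have h1 := (Finset.sum_eq_sum_iff_of_le (s := Finset.univ) (fun j _ =>
    mul_le_mul_of_nonneg_right (by exact_mod_cast h j : (v j : ℝ) ≤ w j) (hl j).le)).1 heq j
    (Finset.mem_univ j)
  exact_mod_cast mul_right_cancel₀ (hl j).ne' h1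

variable {S : Type*} [AddCommGroup S]

lemma map_leftEnd (f : R →+ S) (l : Fin n → R) (i : Fin n) :
    f (leftEnd l i) = leftEnd (fun j => f (l j)) i := map_sum f _ _

lemma map_rightEnd (f : R →+ S) (l : Fin n → R) (i : Fin n) :
    f (rightEnd l i) = rightEnd (fun j => f (l j)) i := by
  simp [rightEnd, map_leftEnd]

lemma map_branch (f : R →+ S) (l : Fin n → R) (p : Fin n → ℤ) (i : Fin n) (x : R) :
    f (branch l p i x) = branch (fun j => f (l j)) p i (f x) := by
  have h : f (imageLeftEnd l p i) = imageLeftEnd (fun j => f (l j)) p i := map_sum f _ _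
  unfold branch
  split_ifs <;> simp [h, map_leftEnd]

lemma IsNested.map [PartialOrder R] [PartialOrder S] {f : R →+ S} (hf : Monotone f)
    {l l' : Fin n → R} {j i : Fin n} (h : IsNested l l' j i) :
    IsNested (fun j => f (l j)) (fun j => f (l' j)) j i := by
  unfold IsNested
  simp only [← map_leftEnd, ← map_rightEnd]
  exact ⟨hf h.1, hf h.2⟩

lemma IsFloor.map [PartialOrder R] [PartialOrder S] {f : R →+ S} (hf : Monotone f)
    {l l' : Fin n → R} {p : Fin n → ℤ} {j : Fin n} {u v : R} (h : IsFloor l p l' j u v) :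
    IsFloor (fun j => f (l j)) p (fun j => f (l' j)) j (f u) (f v) := by
  rcases h with ⟨rfl, rfl⟩ | ⟨i, hi, ⟨hp, rfl, rfl⟩ | ⟨hp, rfl, rfl⟩⟩
  · exact .inl ⟨map_leftEnd .., map_rightEnd ..⟩
  · refine .inr ⟨i, hi.map hf, .inl ⟨hp, ?_, ?_⟩⟩ <;>
      simp only [map_branch, map_leftEnd, map_rightEnd]
  · refine .inr ⟨i, hi.map hf, .inr ⟨hp, ?_, ?_⟩⟩ <;>
      simp only [map_branch, map_leftEnd, map_rightEnd]

lemma IsInduction.map [PartialOrder R] [PartialOrder S] {f : R →+ S} (hf : Monotone f)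
    (hinj : ∀ {v w : R}, v ≤ w → v ≠ w → f v ≠ f w) {M : Matrix (Fin n) (Fin n) ℤ}
    {l l' : Fin n → R} {p p' : Fin n → ℤ} (h : IsInduction M l p l' p') :
    IsInduction M (fun j => f (l j)) p (fun j => f (l' j)) p' := by
  obtain ⟨h1, h2, h3⟩ := h
  refine ⟨fun j => ?_, fun i => ?_, fun i hi => ?_⟩
  · rcases h1 j with ⟨i, a, b, c⟩ | ⟨i, k, a, b, c, d, e⟩
    · exact .inl ⟨i, a.map hf, b, by simpa only [map_branch, map_leftEnd] using congrArg f c⟩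
    · have c1 := hf c.1
      have c2 := hf c.2
      have d1 := hf d.1
      have d2 := hf d.2
      have e' := congrArg f e
      simp only [map_branch, map_leftEnd, map_rightEnd] at c1 c2 d1 d2 e'
      exact .inr ⟨i, k, a.map hf, b, ⟨c1, c2⟩, ⟨d1, d2⟩, e'⟩
  · rcases h2 i with ⟨j, a, b⟩ | ⟨j, k, a, b, c⟩
    · have b' := b.map hf
      rw [map_leftEnd, map_rightEnd] at b'
      exact .inl ⟨j, a, b'⟩
    · have b' := b.map hf
      have c' := c.map hf
      rw [map_add, map_leftEnd] at b' c'
      rw [map_rightEnd] at c'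
      exact .inr ⟨j, k, a, b', c'⟩
  · obtain ⟨j, hj, a | ⟨k, a, b, c⟩⟩ := h3 i hi
    · exact ⟨j, hj, .inl (by simpa only [map_leftEnd] using congrArg f a)⟩
    · have a1 := hf a.1
      have a2 := hinj a.1 a.2
      have b1 := hf b.1
      have b2 := hinj b.1 b.2
      have c' := congrArg f c
      simp only [map_branch, map_leftEnd, map_rightEnd] at a1 a2 b1 b2 c'
      exact ⟨j, hj, .inr ⟨k, ⟨a1, a2⟩, ⟨b1, b2⟩, c'⟩⟩

lemma toReal_mulVec_apply {m : ℕ} (M : Matrix (Fin (m + 1)) (Fin (m + 1)) ℤ)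
    (l : Fin (m + 1) → ℝ) (i : Fin (m + 1)) : (toReal M).mulVec l i = dotHom l (M i) := rfl

lemma IsFormalInduction.isInduction {m : ℕ} {M : Matrix (Fin (m + 1)) (Fin (m + 1)) ℤ}
    {p p' : Fin (m + 1) → ℤ} (h : IsFormalInduction M p p') {l' : Fin (m + 1) → ℝ}
    (hl : ∀ i, 0 < l' i) : IsInduction M ((toReal M).mulVec l') p l' p' := by
  have := IsInduction.map (dotHom_mono hl) (dotHom_injOn_le hl) h
  simp only [dotHom_single] at this
  exact this

end Branches


/-! ### What passes through a step of Rauzy induction -/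

section RealInduction

open Set

variable {n : ℕ} {M : Matrix (Fin n) (Fin n) ℤ} {l l' : Fin n → ℝ} {p p' : Fin n → ℤ}

/-- The increments of `F` over the closed intervals of the partition `l` are those over the image
intervals, up to the sign given by `p`. For the distribution function of a measure without atoms
this is invariance under `E(l, p)`. -/
def IsEquivariant (F : ℝ → ℝ) (l : Fin n → ℝ) (p : Fin n → ℤ) : Prop :=
  ∀ i, ∀ u ∈ Icc (leftEnd l i) (rightEnd l i), ∀ v ∈ Icc (leftEnd l i) (rightEnd l i),
    F (branch l p i v) - F (branch l p i u) = if 0 < p i then F v - F u else F u - F v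

/-- Membership in `O` is invariant under `E(l, p)`, on the open intervals of the partition. -/
def IsSaturated (O : Set ℝ) (l : Fin n → ℝ) (p : Fin n → ℤ) : Prop :=
  ∀ i, ∀ x ∈ Ioo (leftEnd l i) (rightEnd l i), branch l p i x ∈ O ↔ x ∈ O

/-- On each interval of the partition `l`, the function `φ` stays within `ε` of its common value at
the two ends. -/
def OscLE (φ : ℝ → ℝ) (ε : ℝ) (l : Fin n → ℝ) : Prop :=
  ∀ i, φ (rightEnd l i) = φ (leftEnd l i) ∧
    ∀ x ∈ Icc (leftEnd l i) (rightEnd l i), |φ x - φ (leftEnd l i)| ≤ ε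

/-- The increments of `F` over the intervals of the partition `l`. -/
def increments (F : ℝ → ℝ) (l : Fin n → ℝ) (i : Fin n) : ℝ := F (rightEnd l i) - F (leftEnd l i)

lemma branch_mem_Icc {a b : ℝ} {i : Fin n} {u v x : ℝ} (hu : branch l p i u ∈ Icc a b)
    (hv : branch l p i v ∈ Icc a b) (hx : x ∈ Icc u v) : branch l p i x ∈ Icc a b := by
  rw [branch_eq l p i x u] at hu
  rw [branch_eq l p i x v] at hv
  obtain ⟨hu1, hu2⟩ := hu
  obtain ⟨hv1, hv2⟩ := hv
  obtain ⟨h1, h2⟩ := hx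
  split_ifs at * <;> constructor <;> linarith

lemma branch_mem_Ioo {a b : ℝ} {i : Fin n} {u v x : ℝ} (hu : branch l p i u ∈ Icc a b)
    (hv : branch l p i v ∈ Icc a b) (hx : x ∈ Ioo u v) : branch l p i x ∈ Ioo a b := by
  rw [branch_eq l p i x u] at hu
  rw [branch_eq l p i x v] at hv
  obtain ⟨hu1, hu2⟩ := hu
  obtain ⟨hv1, hv2⟩ := hv
  obtain ⟨h1, h2⟩ := hx
  split_ifs at * <;> constructor <;> linarith

lemma BranchesCompose.branch_cases (h : BranchesCompose l p l' p') (j : Fin n) :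
    (∃ i, IsNested l l' j i ∧ (0 < p' j ↔ 0 < p i) ∧ ∀ x, branch l' p' j x = branch l p i x) ∨
    ∃ i k, IsNested l l' j i ∧ (0 < p' j ↔ (0 < p i ↔ 0 < p k)) ∧
      branch l p i (leftEnd l' j) ∈ Icc (leftEnd l k) (rightEnd l k) ∧
      branch l p i (rightEnd l' j) ∈ Icc (leftEnd l k) (rightEnd l k) ∧
      ∀ x, branch l' p' j x = branch l p k (branch l p i x) := by
  rcases h j with ⟨i, a, b, c⟩ | ⟨i, k, a, b, c, d, e⟩
  · refine .inl ⟨i, a, b, fun x => ?_⟩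
    rw [branch_eq l' p' j (leftEnd l' j), branch_eq l p i (leftEnd l' j), c]
    simp only [b]
  · refine .inr ⟨i, k, a, b, c, d, fun x => ?_⟩
    rw [branch_eq l' p' j (leftEnd l' j), branch_eq l p k (branch l p i (leftEnd l' j)), e,
      branch_eq l p i (leftEnd l' j) x]
    by_cases h1 : 0 < p i <;> by_cases h2 : 0 < p k <;> simp [b, h1, h2]

lemma IsNested.Icc_subset {j i : Fin n} (h : IsNested l l' j i) :
    Icc (leftEnd l' j) (rightEnd l' j) ⊆ Icc (leftEnd l i) (rightEnd l i) :=
  Icc_subset_Icc h.1 h.2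

lemma IsInduction.isEquivariant (h : IsInduction M l p l' p') {F : ℝ → ℝ}
    (hF : IsEquivariant F l p) : IsEquivariant F l' p' := by
  intro j u hu v hv
  rcases h.1.branch_cases j with ⟨i, a, b, c⟩ | ⟨i, k, a, b, c, d, e⟩
  · rw [c, c, hF i u (a.Icc_subset hu) v (a.Icc_subset hv)]
    simp only [b]
  · rw [e, e, hF k _ (branch_mem_Icc c d hu) _ (branch_mem_Icc c d hv)]
    have h1 := hF i u (a.Icc_subset hu) v (a.Icc_subset hv)
    by_cases hi : 0 < p i <;> by_cases hk : 0 < p k <;> simp only [b, hi, hk] at h1 ⊢ <;>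
      simp at h1 ⊢ <;> linarith

lemma IsInduction.isSaturated (h : IsInduction M l p l' p') {O : Set ℝ}
    (hO : IsSaturated O l p) : IsSaturated O l' p' := by
  intro j x hx
  rcases h.1.branch_cases j with ⟨i, a, b, c⟩ | ⟨i, k, a, b, c, d, e⟩
  · rw [c, hO i x (Ioo_subset_Ioo a.1 a.2 hx)]
  · rw [e, hO k _ (branch_mem_Ioo c d hx), hO i x (Ioo_subset_Ioo a.1 a.2 hx)]

/-- If a saturated set contains an interior end point of the partition, then also one of the
induced partition. -/
lemma IsInduction.exists_leftEnd_mem (h : IsInduction M l p l' p') {O : Set ℝ}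
    (hO : IsSaturated O l p) (hi : ∃ i : Fin n, (i : ℕ) ≠ 0 ∧ leftEnd l i ∈ O) :
    ∃ j : Fin n, (j : ℕ) ≠ 0 ∧ leftEnd l' j ∈ O := by
  obtain ⟨i, hi0, hi⟩ := hi
  obtain ⟨j, hj, a | ⟨k, a, b, c⟩⟩ := h.2.2 i hi0
  · exact ⟨j, hj, a ▸ hi⟩
  · refine ⟨j, hj, (hO k _ ⟨lt_of_le_of_ne a.1 a.2, lt_of_le_of_ne b.1 b.2⟩).1 ?_⟩
    rwa [c]

lemma IsFloor.increment_eq {F : ℝ → ℝ} (hF : IsEquivariant F l p) {j : Fin n} (hj : 0 ≤ l' j)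
    {u v : ℝ} (h : IsFloor l p l' j u v) : F v - F u = increments F l' j := by
  have hl : leftEnd l' j ∈ Icc (leftEnd l' j) (rightEnd l' j) := by simp [rightEnd, hj]
  have hr : rightEnd l' j ∈ Icc (leftEnd l' j) (rightEnd l' j) := by simp [rightEnd, hj]
  rcases h with ⟨rfl, rfl⟩ | ⟨i, hi, ⟨hp, rfl, rfl⟩ | ⟨hp, rfl, rfl⟩⟩
  · rfl
  · rw [hF i _ (hi.Icc_subset hl) _ (hi.Icc_subset hr), if_pos hp, increments]
  · rw [hF i _ (hi.Icc_subset hr) _ (hi.Icc_subset hl), if_neg hp, increments]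

lemma IsFloor.abs_sub_le {φ : ℝ → ℝ} (hφ : IsEquivariant φ l p) {ε : ℝ} {j : Fin n}
    (hj : 0 ≤ l' j) (hε : OscLE φ ε l') {u v : ℝ} (h : IsFloor l p l' j u v) {x : ℝ}
    (hx : x ∈ Icc u v) : |φ x - φ u| ≤ ε := by
  have hr : rightEnd l' j ∈ Icc (leftEnd l' j) (rightEnd l' j) := by simp [rightEnd, hj]
  have hl : leftEnd l' j ∈ Icc (leftEnd l' j) (rightEnd l' j) := by simp [rightEnd, hj]
  rcases h with ⟨rfl, rfl⟩ | ⟨i, hi, ⟨hp, rfl, rfl⟩ | ⟨hp, rfl, rfl⟩⟩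
  · exact (hε j).2 x hx
  · set y := leftEnd l' j + (x - branch l p i (leftEnd l' j)) with hy
    have hxy : x = branch l p i y := by
      rw [branch_eq l p i (leftEnd l' j) y, if_pos hp]
      linarith
    have hyI : y ∈ Icc (leftEnd l' j) (rightEnd l' j) := by
      rw [branch_eq l p i (leftEnd l' j) (rightEnd l' j), if_pos hp] at hx
      constructor <;> linarith [hx.1, hx.2]
    rw [hxy, hφ i _ (hi.Icc_subset hl) _ (hi.Icc_subset hyI), if_pos hp]
    exact (hε j).2 y hyI
  · set y := leftEnd l' j - (x - branch l p i (leftEnd l' j)) with hy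
    have hxy : x = branch l p i y := by
      rw [branch_eq l p i (leftEnd l' j) y, if_neg hp]
      linarith
    have hyI : y ∈ Icc (leftEnd l' j) (rightEnd l' j) := by
      rw [branch_eq l p i (leftEnd l' j) (rightEnd l' j), if_neg hp] at hx
      constructor <;> linarith [hx.1, hx.2]
    rw [hxy, hφ i _ (hi.Icc_subset hr) _ (hi.Icc_subset hyI), if_neg hp, (hε j).1, abs_sub_comm]
    exact (hε j).2 y hyI

/-- The bound on oscillations passes from an induced partition back to the original one, without
loss: at the cuts between floors `φ` returns to the same value. -/
lemma IsInduction.oscLE (h : IsInduction M l p l' p') (hl' : ∀ j, 0 ≤ l' j) {φ : ℝ → ℝ}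
    (hφ : IsEquivariant φ l p) {ε : ℝ} (hε : OscLE φ ε l') : OscLE φ ε l := by
  have hinc (j : Fin n) {u v : ℝ} (hf : IsFloor l p l' j u v) : φ v = φ u := by
    have h1 := hf.increment_eq hφ (hl' j)
    rw [increments, (hε j).1] at h1
    linarith
  intro i
  rcases h.2.1 i with ⟨j, -, a⟩ | ⟨j, k, -, a, b⟩
  · exact ⟨hinc j a, fun x hx => a.abs_sub_le hφ (hl' j) hε hx⟩
  · refine ⟨(hinc k b).trans (hinc j a), fun x hx => ?_⟩
    rcases le_total x (leftEnd l i + l' j) with hle | hle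
    · exact a.abs_sub_le hφ (hl' j) hε ⟨hx.1, hle⟩
    · rw [← hinc j a]
      exact b.abs_sub_le hφ (hl' k) hε ⟨hle, hx.2⟩

end RealInduction

/-! ### What passes along a Rauzy path -/

section RauzyPaths

open Set

variable {m : ℕ}

lemma IsInduction.increments_eq {M : Matrix (Fin (m + 1)) (Fin (m + 1)) ℤ}
    {l l' : Fin (m + 1) → ℝ} {p p' : Fin (m + 1) → ℤ} (h : IsInduction M l p l' p')
    (hl' : ∀ j, 0 ≤ l' j) {F : ℝ → ℝ} (hF : IsEquivariant F l p) :
    increments F l = (toReal M).mulVec (increments F l') := by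
  funext i
  rw [toReal_mulVec_apply]
  rcases h.2.1 i with ⟨j, hM, a⟩ | ⟨j, k, hM, a, b⟩
  · rw [hM, dotHom_single, ← a.increment_eq hF (hl' j), increments]
  · rw [hM, map_add, dotHom_single, dotHom_single, ← a.increment_eq hF (hl' j),
      ← b.increment_eq hF (hl' k), increments]
    ring

lemma toReal_mul (A B : Matrix (Fin (m + 1)) (Fin (m + 1)) ℤ) :
    toReal (A * B) = toReal A * toReal B :=
  Matrix.map_mul (f := Int.castRingHom ℝ)

/-- Along the path with itinerary `w` from `p`, each step is an induction, whatever the positive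
lengths at its end; the rows of its matrix are nonnegative and nonzero, so that the lengths at its
start are positive, too. -/
def IsInductionPath : List RauzyType → (Fin (m + 1) → ℤ) → Prop
  | [], _ => True
  | t :: w, p => (IsFormalInduction (mat t p) p (move t p) ∧ ∀ i, 0 ≤ mat t p i ∧ mat t p i ≠ 0) ∧
      IsInductionPath w (move t p)

variable {w : List RauzyType} {p : Fin (m + 1) → ℤ} {l' : Fin (m + 1) → ℝ}

lemma IsInductionPath.pos (h : IsInductionPath w p) (hl : ∀ i, 0 < l' i) (i : Fin (m + 1)) :
    0 < (toReal (pathMatrix w p)).mulVec l' i := by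
  induction w generalizing p i with
  | nil => simpa [pathMatrix, toReal] using hl i
  | cons t w ih =>
    rw [pathMatrix, toReal_mul, ← Matrix.mulVec_mulVec, toReal_mulVec_apply]
    have h1 : ∀ j, 0 < (toReal (pathMatrix w (move t p))).mulVec l' j := fun j => ih h.2 j
    refine lt_of_le_of_ne ?_ ?_ <;>
      rw [← map_zero (dotHom ((toReal (pathMatrix w (move t p))).mulVec l'))]
    · exact dotHom_mono h1 (h.1.2 i).1
    · exact dotHom_injOn_le h1 (h.1.2 i).1 (h.1.2 i).2.symm

lemma IsInductionPath.isInduction_cons {t : RauzyType} (h : IsInductionPath (t :: w) p)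
    (hl : ∀ i, 0 < l' i) :
    IsInduction (mat t p) ((toReal (pathMatrix (t :: w) p)).mulVec l') p
      ((toReal (pathMatrix w (move t p))).mulVec l') (move t p) := by
  rw [pathMatrix, toReal_mul, ← Matrix.mulVec_mulVec]
  exact h.1.1.isInduction (h.2.pos hl)

lemma toReal_one : toReal (1 : Matrix (Fin (m + 1)) (Fin (m + 1)) ℤ) = 1 := by
  simp [toReal]

lemma IsInductionPath.isEquivariant (h : IsInductionPath w p) (hl : ∀ i, 0 < l' i) {F : ℝ → ℝ}
    (hF : IsEquivariant F ((toReal (pathMatrix w p)).mulVec l') p) :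
    IsEquivariant F l' (pathEnd w p) := by
  induction w generalizing p with
  | nil => simpa [pathMatrix, pathEnd, toReal_one] using hF
  | cons t w ih => exact ih h.2 ((h.isInduction_cons hl).isEquivariant hF)

lemma IsInductionPath.isSaturated (h : IsInductionPath w p) (hl : ∀ i, 0 < l' i) {O : Set ℝ}
    (hO : IsSaturated O ((toReal (pathMatrix w p)).mulVec l') p) :
    IsSaturated O l' (pathEnd w p) := by
  induction w generalizing p with
  | nil => simpa [pathMatrix, pathEnd, toReal_one] using hO
  | cons t w ih => exact ih h.2 ((h.isInduction_cons hl).isSaturated hO)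

lemma IsInductionPath.exists_leftEnd_mem (h : IsInductionPath w p) (hl : ∀ i, 0 < l' i)
    {O : Set ℝ} (hO : IsSaturated O ((toReal (pathMatrix w p)).mulVec l') p)
    (hi : ∃ i : Fin (m + 1), (i : ℕ) ≠ 0 ∧
      leftEnd ((toReal (pathMatrix w p)).mulVec l') i ∈ O) :
    ∃ j : Fin (m + 1), (j : ℕ) ≠ 0 ∧ leftEnd l' j ∈ O := by
  induction w generalizing p with
  | nil => simpa [pathMatrix, toReal_one] using hi
  | cons t w ih =>
    exact ih h.2 ((h.isInduction_cons hl).isSaturated hO)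
      ((h.isInduction_cons hl).exists_leftEnd_mem hO hi)

lemma IsInductionPath.oscLE (h : IsInductionPath w p) (hl : ∀ i, 0 < l' i) {φ : ℝ → ℝ}
    (hφ : IsEquivariant φ ((toReal (pathMatrix w p)).mulVec l') p) {ε : ℝ} (hε : OscLE φ ε l') :
    OscLE φ ε ((toReal (pathMatrix w p)).mulVec l') := by
  induction w generalizing p with
  | nil => simpa [pathMatrix, toReal_one] using hε
  | cons t w ih =>
    exact (h.isInduction_cons hl).oscLE (fun j => (h.2.pos hl j).le) hφ
      (ih h.2 ((h.isInduction_cons hl).isEquivariant hφ))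

lemma IsInductionPath.increments_eq (h : IsInductionPath w p) (hl : ∀ i, 0 < l' i) {F : ℝ → ℝ}
    (hF : IsEquivariant F ((toReal (pathMatrix w p)).mulVec l') p) :
    increments F ((toReal (pathMatrix w p)).mulVec l') =
      (toReal (pathMatrix w p)).mulVec (increments F l') := by
  induction w generalizing p with
  | nil => simp [pathMatrix, toReal_one]
  | cons t w ih =>
    rw [(h.isInduction_cons hl).increments_eq (fun j => (h.2.pos hl j).le) hF,
      ih h.2 ((h.isInduction_cons hl).isEquivariant hF), Matrix.mulVec_mulVec, ← toReal_mul,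
      pathMatrix]

lemma IsInductionPath.append {w' : List RauzyType} (h : IsInductionPath w p)
    (h' : IsInductionPath w' (pathEnd w p)) : IsInductionPath (w ++ w') p := by
  induction w generalizing p with
  | nil => exact h'
  | cons t w ih => exact ⟨h.1, ih h.2 h'⟩

lemma pathEnd_append (w w' : List RauzyType) (p : Fin (m + 1) → ℤ) :
    pathEnd (w ++ w') p = pathEnd w' (pathEnd w p) := by
  induction w generalizing p with
  | nil => rfl
  | cons t w ih => exact ih _

lemma pathMatrix_append (w w' : List RauzyType) (p : Fin (m + 1) → ℤ) :
    pathMatrix (w ++ w') p = pathMatrix w p * pathMatrix w' (pathEnd w p) := by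
  induction w generalizing p with
  | nil => simp [pathMatrix, pathEnd]
  | cons t w ih => simp [pathMatrix, pathEnd, ih, mul_assoc]

end RauzyPaths


/-! ### Contraction by positive matrices -/

section PerronFrobenius

open Matrix Filter Topology

variable {ι : Type*} [Fintype ι]

/-- A positive matrix with Perron–Frobenius eigenvectors `η` and `v` contracts the hyperplane
`η ⬝ y = 0`, relative to the eigenvalue, in the norm weighted by `η`: subtracting the multiple
`η_j / ∑ η` from the `j`-th column changes nothing there. -/
lemma sum_mul_abs_mulVec_le {B : Matrix ι ι ℝ} (hB : ∀ i j, 1 ≤ B i j) {η : ι → ℝ}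
    (hη : ∀ i, 0 < η i) {τ : ℝ} (hηB : η ᵥ* B = τ • η) {y : ι → ℝ} (hy : η ⬝ᵥ y = 0) :
    ∑ i, η i * |(B *ᵥ y) i| ≤ (τ - 1) * ∑ i, η i * |y i| := by
  rcases isEmpty_or_nonempty ι with _ | _
  · simp
  set E := ∑ j, η j with hE
  have hE0 : 0 < E := Finset.sum_pos (fun i _ => hη i) Finset.univ_nonempty
  have hle (j : ι) : η j / E ≤ 1 :=
    (div_le_one hE0).2 (Finset.single_le_sum (f := η) (fun i _ => (hη i).le) (Finset.mem_univ j))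
  have h1 (i : ι) : |(B *ᵥ y) i| ≤ ∑ j, (B i j - η j / E) * |y j| := by
    have h2 : (B *ᵥ y) i = ∑ j, (B i j - η j / E) * y j := by
      have h3 : ∑ j, η j / E * y j = 0 := by
        have : ∑ j, η j / E * y j = (η ⬝ᵥ y) / E := by
          simp only [dotProduct, Finset.sum_div]
          exact Finset.sum_congr rfl fun j _ => by ring
        rw [this, hy, zero_div]
      simp only [sub_mul, Finset.sum_sub_distrib, h3, sub_zero]
      rfl
    rw [h2]
    refine (Finset.abs_sum_le_sum_abs _ _).trans (Finset.sum_le_sum fun j _ => ?_)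
    rw [abs_mul, abs_of_nonneg (by linarith [hB i j, hle j])]
  calc ∑ i, η i * |(B *ᵥ y) i|
      ≤ ∑ i, η i * ∑ j, (B i j - η j / E) * |y j| :=
        Finset.sum_le_sum fun i _ => mul_le_mul_of_nonneg_left (h1 i) (hη i).le
    _ = ∑ j, ((η ᵥ* B) j - η j) * |y j| := by
        simp only [Finset.mul_sum]
        rw [Finset.sum_comm]
        refine Finset.sum_congr rfl fun j _ => ?_
        have h4 : ∑ i, η i * (η j / E) = η j := by
          rw [← Finset.sum_mul, ← hE]
          field_simp
        rw [← h4, vecMul, dotProduct, ← Finset.sum_sub_distrib, Finset.sum_mul]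
        refine Finset.sum_congr rfl fun i _ => ?_
        rw [h4]
        ring
    _ = (τ - 1) * ∑ i, η i * |y i| := by
        rw [hηB, Finset.mul_sum]
        refine Finset.sum_congr rfl fun j _ => ?_
        simp only [Pi.smul_apply, smul_eq_mul]
        ring

/-- The intersection of the images of the positive cone under the powers of a positive matrix is
the ray of its Perron–Frobenius eigenvector. -/
lemma exists_eq_smul_of_forall_eq_mulVec {B : Matrix ι ι ℝ} (hB : ∀ i j, 1 ≤ B i j)
    {η v : ι → ℝ} (hη : ∀ i, 0 < η i) (hv : ∀ i, 0 < v i) {τ : ℝ} (hτ : 1 < τ)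
    (hηB : η ᵥ* B = τ • η) (hvB : B *ᵥ v = τ • v) {x : ℕ → ι → ℝ} (hx : ∀ k i, 0 ≤ x k i)
    (hxB : ∀ k, x k = B *ᵥ x (k + 1)) : ∃ d : ℝ, x 0 = d • v := by
  rcases isEmpty_or_nonempty ι with _ | _
  · exact ⟨0, Subsingleton.elim _ _⟩
  have hτ0 : 0 < τ := by linarith
  have hηv : 0 < η ⬝ᵥ v :=
    Finset.sum_pos (fun i _ => mul_pos (hη i) (hv i)) Finset.univ_nonempty
  have hstep (z : ι → ℝ) : η ⬝ᵥ (B *ᵥ z) = τ * (η ⬝ᵥ z) := by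
    rw [dotProduct_mulVec, hηB, smul_dotProduct, smul_eq_mul]
  have hH (k : ℕ) : η ⬝ᵥ x k = η ⬝ᵥ x 0 / τ ^ k := by
    induction k with
    | zero => simp
    | succ k ih =>
      have := hstep (x (k + 1))
      rw [← hxB, ih] at this
      rw [pow_succ, ← div_div, this]
      field_simp
  set d := η ⬝ᵥ x 0 / η ⬝ᵥ v with hd
  have hdv : d * (η ⬝ᵥ v) = η ⬝ᵥ x 0 := div_mul_cancel₀ _ hηv.ne'
  have hx0 (k : ℕ) : 0 ≤ η ⬝ᵥ x k := Finset.sum_nonneg fun i _ => mul_nonneg (hη i).le (hx k i)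
  have hd0 : 0 ≤ d := div_nonneg (hx0 0) hηv.le
  set y : ℕ → ι → ℝ := fun k => x k - (d / τ ^ k) • v with hy
  have hyη (k : ℕ) : η ⬝ᵥ y k = 0 := by
    rw [hy, dotProduct_sub, dotProduct_smul, smul_eq_mul, hH, div_mul_eq_mul_div, hdv, sub_self]
  have hyB (k : ℕ) : y k = B *ᵥ y (k + 1) := by
    simp only [hy]
    rw [mulVec_sub, mulVec_smul, hvB, ← hxB, smul_smul, pow_succ]
    congr 2
    field_simp
  set N : (ι → ℝ) → ℝ := fun z => ∑ i, η i * |z i| with hN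
  have hNy (k : ℕ) : N (y k) ≤ 2 * (η ⬝ᵥ x 0) / τ ^ k := by
    have h1 : N (y k) ≤ ∑ i, (η i * x k i + (d / τ ^ k) * (η i * v i)) := by
      refine Finset.sum_le_sum fun i _ => ?_
      have h2 : |y k i| ≤ x k i + d / τ ^ k * v i := by
        have h3 : 0 ≤ d / τ ^ k * v i := mul_nonneg (by positivity) (hv i).le
        simp only [hy, Pi.sub_apply, Pi.smul_apply, smul_eq_mul]
        exact abs_le.2 ⟨by linarith [hx k i], by linarith [hx k i]⟩
      nlinarith [hη i]
    rw [Finset.sum_add_distrib, ← Finset.mul_sum] at h1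
    change _ ≤ η ⬝ᵥ x k + d / τ ^ k * (η ⬝ᵥ v) at h1
    rw [hH, div_mul_eq_mul_div, hdv] at h1
    exact h1.trans (le_of_eq (by ring))
  have hcontr (k : ℕ) : N (y 0) ≤ (τ - 1) ^ k * N (y k) := by
    induction k with
    | zero => simp
    | succ k ih =>
      refine ih.trans ?_
      rw [pow_succ, mul_assoc]
      refine mul_le_mul_of_nonneg_left ?_ (pow_nonneg (by linarith) k)
      rw [hyB k]
      exact sum_mul_abs_mulVec_le hB hη hηB (hyη (k + 1))
  have hlim : Tendsto (fun k : ℕ => ((τ - 1) / τ) ^ k * (2 * (η ⬝ᵥ x 0))) atTop (𝓝 0) := by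
    have := (tendsto_pow_atTop_nhds_zero_of_lt_one (r := (τ - 1) / τ)
      (div_nonneg (by linarith) hτ0.le) ((div_lt_one hτ0).2 (by linarith))).mul_const
      (2 * (η ⬝ᵥ x 0))
    simpa using this
  have hN0 : N (y 0) ≤ 0 := by
    refine ge_of_tendsto' hlim fun k => (hcontr k).trans ?_
    refine (mul_le_mul_of_nonneg_left (hNy k) (pow_nonneg (by linarith) k)).trans (le_of_eq ?_)
    rw [div_pow]
    ring
  refine ⟨d, funext fun i => ?_⟩
  have h5 : η i * |y 0 i| ≤ N (y 0) :=
    Finset.single_le_sum (f := fun i => η i * |y 0 i|)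
      (fun i _ => mul_nonneg (hη i).le (abs_nonneg _)) (Finset.mem_univ i)
  have h6 : |y 0 i| = 0 := by
    have := hη i
    have := abs_nonneg (y 0 i)
    nlinarith
  have h7 := abs_eq_zero.1 h6
  simp only [hy, Pi.sub_apply, Pi.smul_apply, smul_eq_mul, pow_zero, div_one] at h7
  simp only [Pi.smul_apply, smul_eq_mul]
  linarith

end PerronFrobenius

/-! ### Self-inducing exchanges -/

section Loops

open Set Filter Topology

variable {m : ℕ}

/-- A loop `w` at `p` in the Rauzy graph with positive matrix, a positive eigenvector `v` and a
positive left eigenvector of that matrix: `E(v, p)` induces a copy of itself, scaled by `1 / τ`. -/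
structure IsSelfInducing (w : List RauzyType) (p : Fin (m + 1) → ℤ) (τ : ℝ)
    (v : Fin (m + 1) → ℝ) : Prop where
  path : IsInductionPath w p
  loop : pathEnd w p = p
  one_le : ∀ i j, 1 ≤ pathMatrix w p i j
  one_lt : 1 < τ
  pos : ∀ i, 0 < v i
  mulVec_eq : (toReal (pathMatrix w p)).mulVec v = τ • v
  exists_left : ∃ η : Fin (m + 1) → ℝ, (∀ i, 0 < η i) ∧
    Matrix.vecMul η (toReal (pathMatrix w p)) = τ • η

variable {w : List RauzyType} {p : Fin (m + 1) → ℤ} {τ : ℝ} {v : Fin (m + 1) → ℝ}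

lemma IsSelfInducing.smul_pos (h : IsSelfInducing w p τ v) {s : ℝ} (hs : 0 < s) (k : ℕ)
    (i : Fin (m + 1)) : 0 < ((s / τ ^ k) • v) i := by
  have := h.one_lt
  have := h.pos i
  simp only [Pi.smul_apply, smul_eq_mul]
  positivity

lemma IsSelfInducing.mulVec_level (h : IsSelfInducing w p τ v) (s : ℝ) (k : ℕ) :
    (toReal (pathMatrix w p)).mulVec ((s / τ ^ (k + 1)) • v) = (s / τ ^ k) • v := by
  have := h.one_lt
  rw [Matrix.mulVec_smul, h.mulVec_eq, smul_smul]
  congr 1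
  rw [pow_succ]
  field_simp

lemma IsSelfInducing.isEquivariant (h : IsSelfInducing w p τ v) {s : ℝ} (hs : 0 < s) {F : ℝ → ℝ}
    (hF : IsEquivariant F (s • v) p) (k : ℕ) : IsEquivariant F ((s / τ ^ k) • v) p := by
  induction k with
  | zero => simpa using hF
  | succ k ih =>
    have := h.path.isEquivariant (h.smul_pos hs (k + 1)) (F := F)
    rw [h.mulVec_level, h.loop] at this
    exact this ih

lemma IsSelfInducing.exists_leftEnd_mem (h : IsSelfInducing w p τ v) {s : ℝ} (hs : 0 < s)
    {O : Set ℝ} (hO : IsSaturated O (s • v) p)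
    (hi : ∃ i : Fin (m + 1), (i : ℕ) ≠ 0 ∧ leftEnd (s • v) i ∈ O) (k : ℕ) :
    ∃ i : Fin (m + 1), (i : ℕ) ≠ 0 ∧ leftEnd ((s / τ ^ k) • v) i ∈ O := by
  have key : IsSaturated O ((s / τ ^ k) • v) p ∧
      ∃ i : Fin (m + 1), (i : ℕ) ≠ 0 ∧ leftEnd ((s / τ ^ k) • v) i ∈ O := by
    induction k with
    | zero => simpa only [pow_zero, div_one] using ⟨hO, hi⟩
    | succ k ih =>
      have h1 := h.path.isSaturated (h.smul_pos hs (k + 1)) (O := O)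
      have h2 := h.path.exists_leftEnd_mem (h.smul_pos hs (k + 1)) (O := O)
      rw [h.mulVec_level] at h1 h2
      rw [h.loop] at h1
      exact ⟨h1 ih.1, h2 ih.1 ih.2⟩
  exact key.2

lemma IsSelfInducing.oscLE (h : IsSelfInducing w p τ v) {s : ℝ} (hs : 0 < s) {φ : ℝ → ℝ}
    (hφ : IsEquivariant φ (s • v) p) {ε : ℝ} {k : ℕ} (hk : OscLE φ ε ((s / τ ^ k) • v)) :
    OscLE φ ε (s • v) := by
  induction k with
  | zero => simpa using hk
  | succ k ih =>
    have := h.path.oscLE (h.smul_pos hs (k + 1)) (φ := φ) (ε := ε)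
    rw [h.mulVec_level] at this
    exact ih (this (h.isEquivariant hs hφ k) hk)

/-- The increments of a monotone equivariant function at all levels of a self-inducing exchange are
proportional to the lengths. -/
lemma IsSelfInducing.exists_increments_eq (h : IsSelfInducing w p τ v) {s : ℝ} (hs : 0 < s)
    {F : ℝ → ℝ} (hmono : Monotone F) (hF : IsEquivariant F (s • v) p) :
    ∃ d : ℝ, 0 ≤ d ∧ ∀ k, increments F ((s / τ ^ k) • v) = (d / τ ^ k) • v := by
  obtain ⟨η, hη, hηB⟩ := h.exists_left
  have hτ := h.one_lt
  have hx (k : ℕ) : increments F ((s / τ ^ k) • v) =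
      (toReal (pathMatrix w p)).mulVec (increments F ((s / τ ^ (k + 1)) • v)) := by
    have := h.path.increments_eq (h.smul_pos hs (k + 1)) (F := F)
    rw [h.mulVec_level] at this
    exact this (h.isEquivariant hs hF k)
  have hx0 (k : ℕ) (i : Fin (m + 1)) : 0 ≤ increments F ((s / τ ^ k) • v) i := by
    refine sub_nonneg.2 (hmono ?_)
    have := h.smul_pos hs k i
    simp only [rightEnd]
    linarith
  have key (k : ℕ) : ∃ d : ℝ, increments F ((s / τ ^ k) • v) = d • v :=
    exists_eq_smul_of_forall_eq_mulVec
      (x := fun r => increments F ((s / τ ^ (k + r)) • v))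
      (fun i j => by simpa [toReal] using (by exact_mod_cast h.one_le i j :
        (1 : ℝ) ≤ (pathMatrix w p i j : ℝ)))
      hη h.pos hτ hηB h.mulVec_eq (fun r => hx0 _) (fun r => hx _)
  choose d hd using key
  have hstep (k : ℕ) : d k = τ * d (k + 1) := by
    have h1 := hx k
    rw [hd, hd, Matrix.mulVec_smul, h.mulVec_eq] at h1
    have h2 := congrFun h1 0
    simp only [Pi.smul_apply, smul_eq_mul] at h2
    have := h.pos 0
    refine mul_right_cancel₀ this.ne' ?_
    rw [h2]
    ring
  have hd0 (k : ℕ) : d k = d 0 / τ ^ k := by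
    induction k with
    | zero => simp
    | succ k ih =>
      have := hstep k
      rw [ih] at this
      rw [pow_succ, ← div_div, this]
      field_simp
  refine ⟨d 0, ?_, fun k => by rw [hd, hd0]⟩
  have h1 := hx0 0 0
  rw [hd] at h1
  exact nonneg_of_mul_nonneg_left h1 (h.pos 0)

lemma IsEquivariant.sub_const_mul {n : ℕ} {l : Fin n → ℝ} {q : Fin n → ℤ} {F : ℝ → ℝ}
    (hF : IsEquivariant F l q) (c : ℝ) : IsEquivariant (fun x => F x - c * x) l q := by
  intro i u hu v hv
  have h1 := hF i u hu v hv
  have h2 := branch_eq l q i u v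
  simp only
  rw [h2] at h1 ⊢
  split_ifs at * <;> linarith

lemma OscLE.eq_zero_value {n : ℕ} {l : Fin n → ℝ} {φ : ℝ → ℝ} (h : OscLE φ 0 l) {x : ℝ}
    (hx : x ∈ Icc 0 (∑ i, l i)) : φ x = φ 0 := by
  have key (k : ℕ) (hk : k ≤ n) : φ (∑ i with i.val < k, l i) = φ 0 ∧
      ∀ x ∈ Icc 0 (∑ i with i.val < k, l i), φ x = φ 0 := by
    induction k with
    | zero => simp
    | succ k ih =>
      obtain ⟨h1, h2⟩ := ih (by omega)
      set i : Fin n := ⟨k, by omega⟩ with hi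
      have hleft : leftEnd l i = ∑ j with j.val < k, l j := rfl
      have hright : rightEnd l i = ∑ j with j.val < k + 1, l j := by
        have h3 : (Finset.univ.filter fun j : Fin n => j.val < k + 1) =
            insert i (Finset.univ.filter fun j : Fin n => j.val < k) := by
          ext j
          simp [hi, Fin.ext_iff]
          omega
        rw [h3, Finset.sum_insert (by simp [hi]), rightEnd, hleft, add_comm]
      obtain ⟨h4, h5⟩ := h i
      rw [hright, hleft, h1] at h4
      refine ⟨h4, fun x hx => ?_⟩
      rcases le_total x (leftEnd l i) with hle | hle
      · exact h2 x ⟨hx.1, hle⟩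
      · have h6 := h5 x ⟨hle, hright ▸ hx.2⟩
        rw [hleft, h1] at h6
        exact sub_eq_zero.1 (abs_eq_zero.1 (le_antisymm h6 (abs_nonneg _)))
  have := (key n le_rfl).2 x
  simp only [Fin.is_lt, Finset.filter_true] at this
  exact this hx

variable {w₀ : List RauzyType} {p₀ : Fin (m + 1) → ℤ}

/-- If `E(l, q)` induces a self-inducing exchange, then its monotone equivariant functions are
affine. -/
theorem IsSelfInducing.exists_eq_add_mul (h : IsSelfInducing w p τ v)
    (h₀ : IsInductionPath w₀ p₀) (hend : pathEnd w₀ p₀ = p) {s : ℝ} (hs : 0 < s)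
    {l : Fin (m + 1) → ℝ} (hl : l = (toReal (pathMatrix w₀ p₀)).mulVec (s • v)) {F : ℝ → ℝ}
    (hmono : Monotone F) (hF : IsEquivariant F l p₀) :
    ∃ c, ∀ x ∈ Icc 0 (∑ i, l i), F x = F 0 + c * x := by
  have hτ := h.one_lt
  have hsv (i : Fin (m + 1)) : 0 < (s • v) i := by simpa using h.smul_pos hs 0 i
  subst hl
  have hFs := h₀.isEquivariant hsv hF
  rw [hend] at hFs
  obtain ⟨d, hd, hinc⟩ := h.exists_increments_eq hs hmono hFs
  set c := d / s with hc
  set φ : ℝ → ℝ := fun x => F x - c * x with hφ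
  have hcs : c * s = d := div_mul_cancel₀ _ hs.ne'
  have hosc (k : ℕ) : OscLE φ (d / τ ^ k * ∑ i, v i) ((s / τ ^ k) • v) := by
    intro i
    set l := (s / τ ^ k) • v with hl
    have h1 : F (rightEnd l i) - F (leftEnd l i) = d / τ ^ k * v i := congrFun (hinc k) i
    have h2 : c * l i = d / τ ^ k * v i := by
      rw [hl, Pi.smul_apply, smul_eq_mul, ← hcs]
      ring
    have h3 : rightEnd l i = leftEnd l i + l i := rfl
    have hc0 : 0 ≤ c := div_nonneg hd hs.le
    refine ⟨?_, fun x hx => ?_⟩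
    · simp only [hφ]
      rw [h3] at h1 ⊢
      linarith
    · have h4 := hmono hx.1
      have h5 := hmono hx.2
      have h6 := mul_le_mul_of_nonneg_left hx.1 hc0
      have h7 := mul_le_mul_of_nonneg_left hx.2 hc0
      have h8 : d / τ ^ k * v i ≤ d / τ ^ k * ∑ i, v i :=
        mul_le_mul_of_nonneg_left
          (Finset.single_le_sum (f := v) (fun i _ => (h.pos i).le) (Finset.mem_univ i))
          (by positivity)
      rw [h3] at h1 h5 h7
      simp only [hφ]
      exact abs_le.2 ⟨by linarith, by linarith⟩
  have hφE : IsEquivariant φ (s • v) p := hFs.sub_const_mul c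
  have hosc0 (k : ℕ) := h₀.oscLE hsv (hF.sub_const_mul c) (h.oscLE hs hφE (hosc k))
  have hlim : Tendsto (fun k : ℕ => d / τ ^ k * ∑ i, v i) atTop (𝓝 0) := by
    have h1 : Tendsto (fun k : ℕ => d / τ ^ k) atTop (𝓝 0) :=
      tendsto_const_nhds.div_atTop (tendsto_pow_atTop_atTop_of_one_lt hτ)
    simpa using h1.mul_const (∑ i, v i)
  have hzero : OscLE φ 0 ((toReal (pathMatrix w₀ p₀)).mulVec (s • v)) := fun i =>
    ⟨(hosc0 0 i).1, fun x hx => ge_of_tendsto' hlim fun k => (hosc0 k i).2 x hx⟩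
  refine ⟨c, fun x hx => ?_⟩
  have := hzero.eq_zero_value hx
  simp only [hφ, mul_zero, sub_zero] at this
  linarith

/-- If `E(l, q)` induces a self-inducing exchange, then a saturated set that contains an interior
end point of the partition is infinite: it contains such end points of arbitrarily deep levels, and
these tend to zero. -/
theorem IsSelfInducing.infinite_of_leftEnd_mem (h : IsSelfInducing w p τ v)
    (h₀ : IsInductionPath w₀ p₀) (hend : pathEnd w₀ p₀ = p) {s : ℝ} (hs : 0 < s)
    {l : Fin (m + 1) → ℝ} (hl : l = (toReal (pathMatrix w₀ p₀)).mulVec (s • v)) {O : Set ℝ}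
    (hO : IsSaturated O l p₀) (hi : ∃ i : Fin (m + 1), (i : ℕ) ≠ 0 ∧ leftEnd l i ∈ O) :
    O.Infinite := by
  have hτ := h.one_lt
  have hsv (i : Fin (m + 1)) : 0 < (s • v) i := by simpa using h.smul_pos hs 0 i
  subst hl
  have h1 := h₀.isSaturated hsv hO
  rw [hend] at h1
  have h2 := h.exists_leftEnd_mem hs h1 (h₀.exists_leftEnd_mem hsv hO hi)
  have h3 (k : ℕ) : ∃ x ∈ O, 0 < x ∧ x ≤ s / τ ^ k * ∑ i, v i := by
    obtain ⟨i, hi, hx⟩ := h2 k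
    refine ⟨_, hx, Finset.sum_pos (fun j _ => h.smul_pos hs k j)
      ⟨0, Finset.mem_filter.2 ⟨Finset.mem_univ _, Fin.lt_def.2 (Nat.pos_of_ne_zero hi)⟩⟩, ?_⟩
    rw [Finset.mul_sum]
    exact Finset.sum_le_sum_of_subset_of_nonneg (Finset.subset_univ _)
      fun j _ _ => (h.smul_pos hs k j).le
  intro hfin
  obtain ⟨x₀, hx₀, hx₀0, -⟩ := h3 0
  obtain ⟨x, ⟨-, hx0⟩, hmin⟩ := (hfin.subset inter_subset_left :
    (O ∩ Ioi 0).Finite).exists_minimalFor id _ ⟨x₀, hx₀, hx₀0⟩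
  have hlim : Tendsto (fun k : ℕ => s / τ ^ k * ∑ i, v i) atTop (𝓝 0) := by
    have h1 : Tendsto (fun k : ℕ => s / τ ^ k) atTop (𝓝 0) :=
      tendsto_const_nhds.div_atTop (tendsto_pow_atTop_atTop_of_one_lt hτ)
    simpa using h1.mul_const (∑ i, v i)
  obtain ⟨k, hk⟩ := (hlim.eventually (gt_mem_nhds hx0)).exists
  obtain ⟨y, hyO, hy0, hy⟩ := h3 k
  have : y < x := hy.trans_lt hk
  exact absurd (hmin ⟨hyO, hy0⟩ this.le) (not_le.2 this)

end Loops


/-! ### The special cycle and the path that ends on it -/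

section Paths

/-- Irreducibility, as a condition on the entries that can be checked by evaluation. -/
abbrev HasIrreducibleEntries {m : ℕ} (p : Fin (m + 1) → ℤ) : Prop :=
  (∀ i, 1 ≤ (p i).natAbs ∧ (p i).natAbs ≤ m + 1) ∧
    (∀ i j, (p i).natAbs = (p j).natAbs → i = j) ∧
    ∀ k : Fin m, ∃ i : Fin (m + 1), (i : ℕ) ≤ k ∧ (k : ℕ) + 2 ≤ (p i).natAbs

lemma HasIrreducibleEntries.isIrreducibleSigned {m : ℕ} {p : Fin (m + 1) → ℤ}
    (h : HasIrreducibleEntries p) : IsIrreducibleSigned p := by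
  obtain ⟨hp, hinj, hirr⟩ := h
  let f : Fin (m + 1) → Fin (m + 1) := fun i => ⟨(p i).natAbs - 1, by have := hp i; omega⟩
  have hf : Function.Injective f := fun i j h => hinj i j (by
    have h1 := Fin.ext_iff.1 h
    have := hp i
    have := hp j
    simp only [f] at h1
    omega)
  refine ⟨Equiv.ofBijective f (Finite.injective_iff_bijective.1 hf),
    fun i => if 0 < p i then 1 else -1, fun i => ?_, fun k hk1 hkn himg => ?_⟩
  · have := hp i
    simp only [Equiv.ofBijective_apply, f]
    split_ifs <;> push_cast <;> omega
  · by_contra hne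
    obtain ⟨i, hi1, hi2⟩ := hirr ⟨k - 1, by omega⟩
    have h1 : f i ∈ {i : Fin (m + 1) | (i : ℕ) < k} := by
      rw [← himg]
      exact ⟨i, by simp at hi1 ⊢; omega, rfl⟩
    simp [f] at h1 hi2
    omega

/-- The path with itinerary `w` from `p` is a path of inductions through irreducible signed
permutations; it ends at `q` and has the product matrix `M`. -/
def IsVerifiedPath {m : ℕ} (w : List RauzyType) (p q : Fin (m + 1) → ℤ)
    (M : Matrix (Fin (m + 1)) (Fin (m + 1)) ℤ) : Prop :=
  IsInductionPath w p ∧ pathEnd w p = q ∧ pathMatrix w p = M ∧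
    ∀ k ≤ w.length, IsIrreducibleSigned (pathEnd (w.take k) p)

/-- The conditions for prepending the edge of type `t` from `p` to `p'` to a verified path. -/
def IsVerifiedEdge {m : ℕ} (t : RauzyType) (p p' : Fin (m + 1) → ℤ) : Prop :=
  move t p = p' ∧ IsFormalInduction (mat t p) p p' ∧ (∀ i, 0 ≤ mat t p i ∧ mat t p i ≠ 0) ∧
    HasIrreducibleEntries p

noncomputable instance {m : ℕ} (t : RauzyType) (p p' : Fin (m + 1) → ℤ) :
    Decidable (IsVerifiedEdge t p p') := by
  have (i : Fin (m + 1)) : Decidable (0 ≤ mat t p i) :=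
    inferInstanceAs (Decidable ((0 : Fin (m + 1) → ℤ) ≤ _))
  have (i : Fin (m + 1)) : Decidable (mat t p i ≠ 0) :=
    inferInstanceAs (Decidable ((_ : Fin (m + 1) → ℤ) ≠ 0))
  unfold IsVerifiedEdge
  infer_instance

variable {m : ℕ} {w w' : List RauzyType} {p p' q q' : Fin (m + 1) → ℤ}
  {M M' : Matrix (Fin (m + 1)) (Fin (m + 1)) ℤ}

lemma IsVerifiedPath.cons {t : RauzyType} (h : IsVerifiedEdge t p p')
    (h' : IsVerifiedPath w p' q M') (hM : mat t p * M' = M) : IsVerifiedPath (t :: w) p q M := by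
  obtain ⟨rfl, h1, h2, h3⟩ := h
  obtain ⟨h6, h7, rfl, h8⟩ := h'
  refine ⟨⟨⟨h1, h2⟩, h6⟩, h7, hM, fun k hk => ?_⟩
  cases k with
  | zero => exact h3.isIrreducibleSigned
  | succ k => exact h8 k (by simpa using hk)

lemma IsVerifiedPath.nil (hp : HasIrreducibleEntries p) : IsVerifiedPath [] p p 1 :=
  ⟨trivial, rfl, rfl, fun k _ => by
    rw [List.take_nil]
    exact hp.isIrreducibleSigned⟩

lemma IsVerifiedPath.append (h : IsVerifiedPath w p p' M) (h' : IsVerifiedPath w' p' q M') :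
    IsVerifiedPath (w ++ w') p q (M * M') := by
  obtain ⟨h1, rfl, rfl, h4⟩ := h
  obtain ⟨h5, rfl, rfl, h8⟩ := h'
  refine ⟨h1.append h5, pathEnd_append .., pathMatrix_append .., fun k hk => ?_⟩
  rcases le_total k w.length with hle | hle
  · rw [List.take_append_of_le_length hle]
    exact h4 k hle
  · rw [List.take_append, List.take_of_length_le hle, pathEnd_append]
    exact h8 _ (by simp at hk; omega)

lemma IsVerifiedPath.isRauzyPath (h : IsVerifiedPath w p q M) (hw : w ≠ []) : IsRauzyPath w p :=
  ⟨hw, h.2.2.2⟩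

lemma isVerifiedPath_take_cycle : IsVerifiedPath (cycleTypes.take 5) cycleStart ![4, -3, 1, -2]
    !![1, 1, 1, 1; 0, 1, 0, 0; 0, 0, 1, 1; 1, 2, 1, 0] :=
  .cons (p' := ![-4, -2, 1, -3]) (by decide +kernel)
    (.cons (p' := ![3, -4, -2, 1]) (by decide +kernel)
      (.cons (p' := ![4, -2, -3, 1]) (by decide +kernel)
        (.cons (p' := ![4, 1, -2, -3]) (by decide +kernel)
          (.cons (p' := ![4, -3, 1, -2]) (by decide +kernel)
            (.nil (by decide)) rfl) rfl) rfl) rfl) (by decide +kernel)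

lemma isVerifiedPath_drop_cycle : IsVerifiedPath (cycleTypes.drop 5) ![4, -3, 1, -2] cycleStart
    !![1, 0, 0, 0; 0, 1, 1, 1; 0, 0, 1, 1; 1, 1, 1, 0] :=
  .cons (p' := ![-2, -4, 1, -3]) (by decide +kernel)
    (.cons (p' := ![-2, 3, -4, 1]) (by decide +kernel)
      (.cons (p' := ![-3, 4, -2, 1]) (by decide +kernel)
        (.cons (p' := cycleStart) (by decide +kernel)
          (.nil (by decide)) rfl) rfl) rfl) (by decide +kernel)

lemma isVerifiedPath_tail : IsVerifiedPath tailTypes tailStart ![4, -3, 1, -2]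
    !![1, 1, 1, 0; 0, 0, 1, 1; 0, 1, 0, 0; 1, 1, 0, 0] :=
  .cons (p' := ![-4, -1, 2, -3]) (by decide +kernel)
    (.cons (p' := ![3, -4, -1, 2]) (by decide +kernel)
      (.cons (p' := ![3, -2, -4, -1]) (by decide +kernel)
        (.cons (p' := ![4, -3, 1, -2]) (by decide +kernel)
          (.nil (by decide)) rfl) rfl) rfl) (by decide +kernel)

/-- The matrix of the special cycle. -/
def cycleMatrix : Matrix (Fin 4) (Fin 4) ℤ := !![2, 2, 3, 2; 0, 1, 1, 1; 1, 1, 2, 1; 1, 2, 3, 3]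

lemma isVerifiedPath_cycle : IsVerifiedPath cycleTypes cycleStart cycleStart cycleMatrix := by
  have h := isVerifiedPath_take_cycle.append isVerifiedPath_drop_cycle
  rwa [List.take_append_drop, show _ * _ = cycleMatrix by decide +kernel] at h

end Paths


/-! ### The Perron–Frobenius eigenvectors of the special cycle -/

section Eigenvectors

open Matrix

/-- A nonnegative matrix with a positive left eigenvector has no eigenvalue of larger modulus. -/
lemma norm_le_of_mulVec_eq_smul {m : ℕ} {A : Matrix (Fin (m + 1)) (Fin (m + 1)) ℤ}
    (hA : ∀ i j, 0 ≤ A i j) {σ : ℝ} {η : Fin (m + 1) → ℝ} (hη : ∀ i, 0 < η i)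
    (hηA : η ᵥ* toReal A = σ • η) {z : ℂ} {v : Fin (m + 1) → ℂ} (hv : v ≠ 0)
    (hzv : (A.map (fun k : ℤ => (k : ℂ))) *ᵥ v = z • v) : ‖z‖ ≤ σ := by
  have h1 (i : Fin (m + 1)) : ‖z‖ * ‖v i‖ ≤ ∑ j, (A i j : ℝ) * ‖v j‖ := by
    rw [← norm_mul, ← smul_eq_mul, ← Pi.smul_apply, ← hzv]
    change ‖∑ j, (A.map (fun k : ℤ => (k : ℂ))) i j * v j‖ ≤ _
    refine (norm_sum_le _ _).trans (Finset.sum_le_sum fun j _ => ?_)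
    rw [norm_mul, map_apply, Complex.norm_intCast, abs_of_nonneg (by exact_mod_cast hA i j)]
  have h2 : ‖z‖ * ∑ i, η i * ‖v i‖ ≤ σ * ∑ i, η i * ‖v i‖ := calc
    ‖z‖ * ∑ i, η i * ‖v i‖ = ∑ i, η i * (‖z‖ * ‖v i‖) := by
        rw [Finset.mul_sum]
        exact Finset.sum_congr rfl fun i _ => by ring
    _ ≤ ∑ i, η i * ∑ j, (A i j : ℝ) * ‖v j‖ :=
        Finset.sum_le_sum fun i _ => mul_le_mul_of_nonneg_left (h1 i) (hη i).le
    _ = ∑ j, (η ᵥ* toReal A) j * ‖v j‖ := by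
        simp only [Finset.mul_sum, vecMul, dotProduct, Finset.sum_mul, toReal, map_apply]
        rw [Finset.sum_comm]
        exact Finset.sum_congr rfl fun j _ => Finset.sum_congr rfl fun i _ => by ring
    _ = σ * ∑ i, η i * ‖v i‖ := by
        rw [hηA, Finset.mul_sum]
        exact Finset.sum_congr rfl fun i _ => by simp [mul_assoc]
  refine le_of_mul_le_mul_right h2 ?_
  obtain ⟨i, hi⟩ := Function.ne_iff.1 hv
  exact Finset.sum_pos' (fun j _ => mul_nonneg (hη j).le (norm_nonneg _))
    ⟨i, Finset.mem_univ i, mul_pos (hη i) (norm_pos_iff.2 hi)⟩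

/-- The characteristic polynomial of the cycle matrix is `(x - 1) (x ^ 3 - 7 x ^ 2 + 5 x - 1)`; the
cubic factor has a root in `(6, 7)`. -/
lemma exists_root : ∃ σ : ℝ, 6 < σ ∧ σ ^ 3 = 7 * σ ^ 2 - 5 * σ + 1 := by
  have hc : ContinuousOn (fun x : ℝ => x ^ 3 - 7 * x ^ 2 + 5 * x - 1) (Set.Icc 6 7) := by fun_prop
  obtain ⟨σ, hσ, h0⟩ := intermediate_value_Ioo (by norm_num : (6 : ℝ) ≤ 7) hc
    (show (0 : ℝ) ∈ _ by constructor <;> norm_num)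
  exact ⟨σ, hσ.1, by simp only at h0; linarith⟩

variable {σ : ℝ}

/-- The unnormalized right eigenvector of the cycle matrix, for a root `σ` of the cubic factor. -/
def rightVec (σ : ℝ) : Fin 4 → ℝ := ![σ ^ 2 - 3 * σ + 1, σ, 2 * σ - 1, σ ^ 2 - 3 * σ + 1]

/-- The left eigenvector of the cycle matrix, for a root `σ` of the cubic factor. -/
def leftVec (σ : ℝ) : Fin 4 → ℝ :=
  ![σ ^ 2 - 3 * σ + 1, σ ^ 2 - σ, σ ^ 2 + 2 * σ - 1, σ ^ 2]

lemma rightVec_pos (hσ : 6 < σ) (i : Fin 4) : 0 < rightVec σ i := by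
  fin_cases i <;> simp [rightVec] <;> nlinarith

lemma leftVec_pos (hσ : 6 < σ) (i : Fin 4) : 0 < leftVec σ i := by
  fin_cases i <;> simp [leftVec] <;> nlinarith

lemma cycleMatrix_mulVec (h : σ ^ 3 = 7 * σ ^ 2 - 5 * σ + 1) :
    toReal cycleMatrix *ᵥ rightVec σ = σ • rightVec σ := by
  funext i
  fin_cases i <;>
    simp [toReal, cycleMatrix, rightVec, mulVec, dotProduct, Fin.sum_univ_four] <;>
    first | ring1 | linear_combination (-1 : ℝ) * h

lemma vecMul_cycleMatrix (h : σ ^ 3 = 7 * σ ^ 2 - 5 * σ + 1) :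
    leftVec σ ᵥ* toReal cycleMatrix = σ • leftVec σ := by
  funext i
  fin_cases i <;>
    simp [toReal, cycleMatrix, leftVec, vecMul, dotProduct, Fin.sum_univ_four] <;>
    first | ring1 | linear_combination (-1 : ℝ) * h

/-- The normalized Perron–Frobenius eigenvector of the cycle matrix. -/
noncomputable def perronVec (σ : ℝ) : Fin 4 → ℝ := (∑ i, rightVec σ i)⁻¹ • rightVec σ

lemma perronVec_pos (hσ : 6 < σ) (i : Fin 4) : 0 < perronVec σ i :=
  mul_pos (inv_pos.2 (Finset.sum_pos (fun i _ => rightVec_pos hσ i) Finset.univ_nonempty))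
    (rightVec_pos hσ i)

lemma cycleMatrix_mulVec_perronVec (h : σ ^ 3 = 7 * σ ^ 2 - 5 * σ + 1) :
    toReal cycleMatrix *ᵥ perronVec σ = σ • perronVec σ := by
  rw [perronVec, mulVec_smul, cycleMatrix_mulVec h, smul_comm]

lemma isPerronFrobenius_perronVec (hσ : 6 < σ) (h : σ ^ 3 = 7 * σ ^ 2 - 5 * σ + 1) :
    IsPerronFrobenius cycleMatrix σ (perronVec σ) := by
  refine ⟨by linarith, perronVec_pos hσ, ?_, cycleMatrix_mulVec_perronVec h, fun z v hv hz =>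
    norm_le_of_mulVec_eq_smul (m := 3)
      (fun i j => by fin_cases i <;> fin_cases j <;> decide) (leftVec_pos hσ)
      (vecMul_cycleMatrix h) hv hz⟩
  simp only [perronVec, Pi.smul_apply, smul_eq_mul, ← Finset.mul_sum]
  exact inv_mul_cancel₀
    (Finset.sum_pos (fun i _ => rightVec_pos hσ i) Finset.univ_nonempty).ne'

/-- The square of the cycle matrix is positive, so the cycle passed twice induces a scaled copy. -/
lemma isSelfInducing_cycle (hσ : 6 < σ) (h : σ ^ 3 = 7 * σ ^ 2 - 5 * σ + 1) :
    IsSelfInducing (cycleTypes ++ cycleTypes) cycleStart (σ * σ) (perronVec σ) := by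
  obtain ⟨h1, h2, h3, -⟩ := isVerifiedPath_cycle.append isVerifiedPath_cycle
  refine ⟨h1, h2, ?_, by nlinarith, perronVec_pos hσ, ?_, leftVec σ, leftVec_pos hσ, ?_⟩ <;> rw [h3]
  · decide
  · rw [toReal_mul, ← mulVec_mulVec, cycleMatrix_mulVec_perronVec h, mulVec_smul,
      cycleMatrix_mulVec_perronVec h, smul_smul]
  · rw [toReal_mul, ← vecMul_vecMul, vecMul_cycleMatrix h, smul_vecMul, vecMul_cycleMatrix h,
      smul_smul]

lemma isSpecialCycle_cycle : IsSpecialCycle cycleTypes cycleStart := by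
  refine ⟨isVerifiedPath_cycle.isRauzyPath (by simp [cycleTypes]), isVerifiedPath_cycle.2.1, 2,
    by norm_num, ?_⟩
  rw [isVerifiedPath_cycle.2.2.1, pow_two]
  decide

/-- The lengths on the first five steps of the cycle, computed backwards from the eigenvector by the
inverse matrix, are those computed forwards by the remaining four steps. -/
lemma inv_mulVec_perronVec (hσ : 6 < σ) (h : σ ^ 3 = 7 * σ ^ 2 - 5 * σ + 1) :
    (toReal (pathMatrix (cycleTypes.take 5) cycleStart))⁻¹ *ᵥ perronVec σ =
      toReal (pathMatrix (cycleTypes.drop 5) ![4, -3, 1, -2]) *ᵥ (σ⁻¹ • perronVec σ) := by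
  set A := pathMatrix (cycleTypes.take 5) cycleStart with hA
  set B := pathMatrix (cycleTypes.drop 5) ![4, -3, 1, -2] with hB
  have hAB : A * B = cycleMatrix := by
    rw [hA, hB, isVerifiedPath_take_cycle.2.2.1, isVerifiedPath_drop_cycle.2.2.1]
    decide
  -- The left factor below is the inverse of the integer matrix `A`.
  have hinv : (toReal A)⁻¹ * toReal A = 1 := by
    have h1 : toReal !![1, -1, -1, 0; 0, 1, 0, 0; -1, -1, 1, 1; 1, 1, 0, -1] * toReal A = 1 := by
      rw [← toReal_mul, hA, isVerifiedPath_take_cycle.2.2.1, ← toReal_one]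
      congr 1
      decide
    rw [Matrix.inv_eq_left_inv h1, h1]
  have h2 : perronVec σ = toReal A *ᵥ (toReal B *ᵥ (σ⁻¹ • perronVec σ)) := by
    rw [mulVec_mulVec, ← toReal_mul, hAB, mulVec_smul, cycleMatrix_mulVec_perronVec h, smul_smul,
      inv_mul_cancel₀ (by linarith), one_smul]
  conv_lhs => rw [h2]
  rw [mulVec_mulVec, hinv, one_mulVec]

/-- The lengths `l`, of sum one, are such that monotone functions equivariant under `E(l, p)` are
affine, and such that saturated sets that contain an interior end point are infinite. -/
structure IsRigid {m : ℕ} (l : Fin (m + 1) → ℝ) (p : Fin (m + 1) → ℤ) : Prop where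
  pos : ∀ i, 0 < l i
  sum_eq : ∑ i, l i = 1
  exists_eq_add_mul : ∀ F : ℝ → ℝ, Monotone F → IsEquivariant F l p →
    ∃ c, ∀ x ∈ Set.Icc (0 : ℝ) 1, F x = F 0 + c * x
  infinite : ∀ O : Set ℝ, IsSaturated O l p →
    (∃ i : Fin (m + 1), (i : ℕ) ≠ 0 ∧ leftEnd l i ∈ O) → O.Infinite

lemma isRigid_tail (hσ : 6 < σ) (h : σ ^ 3 = 7 * σ ^ 2 - 5 * σ + 1) {μ : Fin 4 → ℝ}
    (hμ : μ = toReal (pathMatrix tailTypes tailStart) *ᵥ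
      ((toReal (pathMatrix (cycleTypes.take 5) cycleStart))⁻¹ *ᵥ perronVec σ)) :
    IsRigid ((∑ i, μ i)⁻¹ • μ) tailStart := by
  have hσ0 : 0 < σ := by linarith
  obtain ⟨hpath, hend, -, -⟩ := isVerifiedPath_tail.append isVerifiedPath_drop_cycle
  have hμ' : μ = toReal (pathMatrix (tailTypes ++ cycleTypes.drop 5) tailStart) *ᵥ
      (σ⁻¹ • perronVec σ) := by
    rw [hμ, inv_mulVec_perronVec hσ h, mulVec_mulVec, ← toReal_mul, pathMatrix_append,
      isVerifiedPath_tail.2.1]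
  have hpos (i : Fin 4) : 0 < μ i := by
    rw [hμ']
    exact hpath.pos (fun j => mul_pos (inv_pos.2 hσ0) (perronVec_pos hσ j)) i
  have hS : 0 < ∑ i, μ i := Finset.sum_pos (fun i _ => hpos i) Finset.univ_nonempty
  set s := (∑ i, μ i)⁻¹ * σ⁻¹ with hs
  have hs0 : 0 < s := mul_pos (inv_pos.2 hS) (inv_pos.2 hσ0)
  have hl : (∑ i, μ i)⁻¹ • μ = toReal (pathMatrix (tailTypes ++ cycleTypes.drop 5) tailStart) *ᵥ
      (s • perronVec σ) := by
    rw [hs, ← smul_smul, mulVec_smul, ← hμ']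
  have hsum : ∑ i, ((∑ i, μ i)⁻¹ • μ) i = 1 := by
    simp only [Pi.smul_apply, smul_eq_mul, ← Finset.mul_sum]
    exact inv_mul_cancel₀ hS.ne'
  have hself := isSelfInducing_cycle hσ h
  refine ⟨fun i => mul_pos (inv_pos.2 hS) (hpos i), hsum, fun F hF hE => ?_, fun O hO hi => ?_⟩
  · have := hself.exists_eq_add_mul hpath hend hs0 hl hF hE
    rwa [hsum] at this
  · exact hself.infinite_of_leftEnd_mem hpath hend hs0 hl hO hi

end Eigenvectors


/-! ### Injective partial maps: orbits, ergodicity, and unique ergodicity -/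

namespace PartialSelfMap

open Set MeasureTheory Topology Filter

variable {Γ : Type*} {T : PartialSelfMap Γ}

lemma mem_orbit_comm {p q : Γ} : q ∈ T.orbit p ↔ p ∈ T.orbit q := by
  simp only [orbit, mem_ofPred_eq]
  exact exists_congr fun n => or_comm

lemma mem_iterDom_succ {n : ℕ} {x : Γ} :
    x ∈ T.iterDom (n + 1) ↔ x ∈ T.dom ∧ T.toFun x ∈ T.iterDom n := by
  constructor
  · intro h
    exact ⟨h 0 (by omega), fun k hk => h (k + 1) (by omega)⟩
  · rintro ⟨h1, h2⟩ k hk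
    cases k with
    | zero => exact h1
    | succ k => exact h2 k (by omega)

lemma mem_iterDom_succ' {n : ℕ} {x : Γ} :
    x ∈ T.iterDom (n + 1) ↔ x ∈ T.iterDom n ∧ T.toFun^[n] x ∈ T.dom := by
  constructor
  · intro h
    exact ⟨fun k hk => h k (by omega), h n (by omega)⟩
  · rintro ⟨h1, h2⟩ k hk
    rcases Nat.lt_succ_iff_lt_or_eq.1 hk with hk | rfl
    · exact h1 k hk
    · exact h2

/-- `W` is invariant under `T` and its inverse. -/
def IsSaturatedSet (T : PartialSelfMap Γ) (W : Set Γ) : Prop :=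
  ∀ x ∈ T.dom, T.toFun x ∈ W ↔ x ∈ W

lemma isSaturatedSet_orbit (hT : InjOn T.toFun T.dom) (p : Γ) : T.IsSaturatedSet (T.orbit p) := by
  intro x hx
  constructor
  · rintro ⟨n, ⟨h1, h2⟩ | ⟨h1, h2⟩⟩
    · cases n with
      | zero => exact ⟨1, .inr ⟨mem_iterDom_succ.2 ⟨hx, fun k hk => absurd hk (by omega)⟩, h2.symm⟩⟩
      | succ n =>
        rw [Function.iterate_succ_apply'] at h2
        obtain ⟨h3, h4⟩ := mem_iterDom_succ'.1 h1
        exact ⟨n, .inl ⟨h3, hT h4 hx h2⟩⟩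
    · exact ⟨n + 1, .inr ⟨mem_iterDom_succ.2 ⟨hx, h1⟩, h2⟩⟩
  · rintro ⟨n, ⟨h1, h2⟩ | ⟨h1, h2⟩⟩
    · refine ⟨n + 1, .inl ⟨mem_iterDom_succ'.2 ⟨h1, h2 ▸ hx⟩, ?_⟩⟩
      rw [Function.iterate_succ_apply', h2]
    · cases n with
      | zero => exact ⟨1, .inl ⟨mem_iterDom_succ.2 ⟨h2 ▸ hx, fun k hk => absurd hk (by omega)⟩,
          congrArg T.toFun h2.symm⟩⟩
      | succ n => exact ⟨n, .inr ⟨(mem_iterDom_succ.1 h1).2, h2⟩⟩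

lemma orbit_apply (hT : InjOn T.toFun T.dom) {x : Γ} (hx : x ∈ T.dom) :
    T.orbit (T.toFun x) = T.orbit x := by
  ext q
  rw [mem_orbit_comm, isSaturatedSet_orbit hT q x hx, mem_orbit_comm]

lemma orbit_iterate (hT : InjOn T.toFun T.dom) {n : ℕ} {x : Γ} (hx : x ∈ T.iterDom n) :
    T.orbit (T.toFun^[n] x) = T.orbit x := by
  induction n with
  | zero => rfl
  | succ n ih =>
    obtain ⟨h1, h2⟩ := mem_iterDom_succ'.1 hx
    rw [Function.iterate_succ_apply', orbit_apply hT h2, ih h1]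

lemma iterate_injOn (hT : InjOn T.toFun T.dom) (n : ℕ) : InjOn T.toFun^[n] (T.iterDom n) := by
  induction n with
  | zero => exact injOn_id _
  | succ n ih =>
    intro x hx y hy h
    obtain ⟨hx1, hx2⟩ := mem_iterDom_succ.1 hx
    obtain ⟨hy1, hy2⟩ := mem_iterDom_succ.1 hy
    exact hT hx1 hy1 (ih hx2 hy2 h)

/-- A finite orbit is periodic, or it ends outside the domain. -/
lemma orbit_infinite (hT : InjOn T.toFun T.dom) (hend : ∀ x ∉ T.dom, (T.orbit x).Infinite)
    (hper : ∀ n > 0, ∀ x ∈ T.iterDom n, T.toFun^[n] x ≠ x) (x : Γ) : (T.orbit x).Infinite := by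
  by_cases h : ∀ n, x ∈ T.iterDom n
  · refine infinite_of_injective_forall_mem (f := fun n => T.toFun^[n] x) ?_
      fun n => ⟨n, .inl ⟨h n, rfl⟩⟩
    have key (i j : ℕ) (hij : i < j) : T.toFun^[i] x ≠ T.toFun^[j] x := by
      intro heq
      refine hper (j - i) (by omega) (T.toFun^[i] x) (fun k hk => ?_) ?_
      · rw [← Function.iterate_add_apply]
        exact h (k + i + 1) _ (by omega)
      · rw [← Function.iterate_add_apply, Nat.sub_add_cancel hij.le, heq]
    intro i j hij
    rcases lt_trichotomy i j with h1 | h1 | h1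
    · exact absurd hij (key i j h1)
    · exact h1
    · exact absurd hij.symm (key j i h1)
  · classical
    push Not at h
    have h0 := Nat.find_spec h
    obtain ⟨n, hn⟩ : ∃ n, Nat.find h = n + 1 := Nat.exists_eq_succ_of_ne_zero fun h1 => by
      rw [h1] at h0
      exact h0 fun k hk => absurd hk (by omega)
    have h1 : x ∈ T.iterDom n := not_not.1 (Nat.find_min h (m := n) (by omega))
    rw [hn, mem_iterDom_succ'] at h0
    rw [← orbit_iterate hT h1]
    exact hend _ fun h2 => h0 ⟨h1, h2⟩

section Measure

variable [MeasurableSpace Γ] {m : Measure Γ}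

lemma IsInvariant.measure_singleton_iterate [MeasurableSingletonClass Γ] (hm : T.IsInvariant m)
    {n : ℕ} {x : Γ} (hx : x ∈ T.iterDom n) : m {T.toFun^[n] x} = m {x} := by
  induction n with
  | zero => rfl
  | succ n ih =>
    obtain ⟨h1, h2⟩ := mem_iterDom_succ'.1 hx
    rw [Function.iterate_succ_apply', ← ih h1,
      ← hm _ (measurableSet_singleton _) (singleton_subset_iff.2 h2), image_singleton]

lemma IsInvariant.nullSingletonClass [MeasurableSingletonClass Γ] [IsFiniteMeasure m]
    (hm : T.IsInvariant m) (horb : ∀ x, (T.orbit x).Infinite) : NullSingletonClass m := by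
  refine ⟨fun x => ?_⟩
  by_contra hx
  have h1 : m (T.orbit x) = ⊤ := (horb x).meas_eq_top ⟨m {x}, hx, ?_⟩
  · exact measure_ne_top m _ h1
  · rintro q ⟨n, ⟨h1, rfl⟩ | ⟨h1, rfl⟩⟩
    · rw [hm.measure_singleton_iterate h1]
    · rw [hm.measure_singleton_iterate h1]

lemma IsInvariant.restrict (hm : T.IsInvariant m) {W : Set Γ}
    (hW : MeasurableSet W) (hsat : T.IsSaturatedSet W) : T.IsInvariant (m.restrict W) := by
  intro A hA hAT
  rw [Measure.restrict_apply' hW, Measure.restrict_apply' hW,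
    ← hm _ (hA.inter hW) (inter_subset_left.trans hAT)]
  congr 1
  ext y
  constructor
  · rintro ⟨⟨x, hx, rfl⟩, hy⟩
    exact ⟨x, ⟨hx, (hsat x (hAT hx)).1 hy⟩, rfl⟩
  · rintro ⟨x, ⟨hx, hxW⟩, rfl⟩
    exact ⟨⟨x, hx, rfl⟩, (hsat x (hAT hx)).2 hxW⟩

/-- Saturated measurable sets are null or conull. -/
def IsErgodicFor (T : PartialSelfMap Γ) (m : Measure Γ) : Prop :=
  ∀ W, MeasurableSet W → T.IsSaturatedSet W → m W = 0 ∨ m Wᶜ = 0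

/-- If `m` is, up to scaling, the only invariant measure without atoms, then it is ergodic: its
restriction to a saturated set is a multiple of it. -/
lemma IsInvariant.isErgodicFor [IsFiniteMeasure m] [NullSingletonClass m]
    (hm : T.IsInvariant m) (huniq : ∀ ν : Measure Γ, IsFiniteMeasure ν → NullSingletonClass ν →
      T.IsInvariant ν → ∃ c : ENNReal, ν = c • m) : T.IsErgodicFor m := by
  intro W hW hsat
  obtain ⟨c, hc⟩ := huniq (m.restrict W) inferInstance inferInstance (hm.restrict hW hsat)
  have h1 : c * m Wᶜ = 0 := by
    have := congrArg (fun ν : Measure Γ => ν Wᶜ) hc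
    simpa [Measure.restrict_apply hW.compl] using this.symm
  rcases mul_eq_zero.1 h1 with rfl | h2
  · left
    have := congrArg (fun ν : Measure Γ => ν W) hc
    simpa using this
  · exact .inr h2

/-- Invariance can be checked on the pieces of a partition of the domain. -/
lemma isInvariant_of_iUnion [StandardBorelSpace Γ] {n : ℕ} {I : Fin n → Set Γ}
    (hT : InjOn T.toFun T.dom) (hmeas : Measurable T.toFun) (hI : ∀ i, MeasurableSet (I i))
    (hdisj : ∀ i j, i ≠ j → Disjoint (I i) (I j)) (hdom : T.dom = ⋃ i, I i)
    (h : ∀ i, ∀ A ⊆ I i, MeasurableSet A → m (T.toFun '' A) = m A) : T.IsInvariant m := by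
  intro A hA hAT
  have h1 : A = ⋃ i, A ∩ I i := by
    rw [← inter_iUnion, ← hdom, inter_eq_left.2 hAT]
  have h2 (i : Fin n) : MeasurableSet (A ∩ I i) := hA.inter (hI i)
  have h3 : Pairwise (Function.onFun Disjoint fun i => A ∩ I i) := fun i j hij =>
    (hdisj i j hij).mono inter_subset_right inter_subset_right
  have h4 (i : Fin n) : A ∩ I i ⊆ T.dom := inter_subset_left.trans hAT
  rw [h1, image_iUnion, measure_iUnion h3 h2, measure_iUnion]
  · exact tsum_congr fun i => h i _ inter_subset_right (h2 i)
  · intro i j hij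
    refine disjoint_left.2 ?_
    rintro _ ⟨x, hx, rfl⟩ ⟨y, hy, hxy⟩
    exact disjoint_left.1 (h3 hij) hx (hT (h4 j hy) (h4 i hx) hxy ▸ hy)
  · exact fun i => (h2 i).image_of_measurable_injOn hmeas (hT.mono (h4 i))

lemma measurableSet_iterDom (hmeas : Measurable T.toFun) (hdom : MeasurableSet T.dom) (n : ℕ) :
    MeasurableSet (T.iterDom n) := by
  have : T.iterDom n = ⋂ k, ⋂ (_ : k < n), T.toFun^[k] ⁻¹' T.dom := by
    ext x
    simp [iterDom]
  rw [this]
  exact .iInter fun k => .iInter fun _ => hmeas.iterate k hdom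

lemma measurableSet_orbit_inter [StandardBorelSpace Γ] (hT : InjOn T.toFun T.dom)
    (hmeas : Measurable T.toFun) (hdom : MeasurableSet T.dom) {U : Set Γ} (hU : MeasurableSet U) :
    MeasurableSet {x | (T.orbit x ∩ U).Nonempty} := by
  have : {x | (T.orbit x ∩ U).Nonempty} = ⋃ n : ℕ, (T.iterDom n ∩ T.toFun^[n] ⁻¹' U) ∪
      T.toFun^[n] '' (T.iterDom n ∩ U) := by
    ext x
    simp only [mem_ofPred_eq, mem_iUnion]
    constructor
    · rintro ⟨q, ⟨n, ⟨h1, h2⟩ | ⟨h1, h2⟩⟩, hq⟩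
      · exact ⟨n, .inl ⟨h1, mem_preimage.2 (h2 ▸ hq)⟩⟩
      · exact ⟨n, .inr ⟨q, ⟨h1, hq⟩, h2⟩⟩
    · rintro ⟨n, ⟨h1, h2⟩ | ⟨q, ⟨h1, hq⟩, h2⟩⟩
      · exact ⟨_, ⟨n, .inl ⟨h1, rfl⟩⟩, h2⟩
      · exact ⟨q, ⟨n, .inr ⟨h1, h2⟩⟩, hq⟩
  rw [this]
  have h1 := measurableSet_iterDom hmeas hdom
  exact .iUnion fun n => ((h1 n).inter (hmeas.iterate n hU)).union
    (((h1 n).inter hU).image_of_measurable_injOn (hmeas.iterate n)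
      ((iterate_injOn hT n).mono inter_subset_left))

/-- Ergodicity for a measure with full support implies that almost every orbit is dense. -/
lemma IsErgodicFor.isTransitive [TopologicalSpace Γ] [PolishSpace Γ] [BorelSpace Γ] [Nonempty Γ]
    [m.IsOpenPosMeasure] (hT : InjOn T.toFun T.dom) (hmeas : Measurable T.toFun)
    (hdom : MeasurableSet T.dom) (hm : T.IsErgodicFor m) : T.IsTransitive := by
  have h1 : ∀ U ∈ TopologicalSpace.countableBasis Γ, ∀ᵐ x ∂m, (T.orbit x ∩ U).Nonempty := by
    intro U hU
    have hUo := TopologicalSpace.isOpen_of_mem_countableBasis hU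
    rcases hm {x | (T.orbit x ∩ U).Nonempty}
      (measurableSet_orbit_inter hT hmeas hdom hUo.measurableSet)
      (fun x hx => by simp only [mem_ofPred_eq, orbit_apply hT hx]) with h | h
    · have h2 : U ⊆ {x | (T.orbit x ∩ U).Nonempty} := fun x hx =>
        ⟨x, ⟨0, .inl ⟨fun k hk => absurd hk (by omega), rfl⟩⟩, hx⟩
      exact absurd (measure_mono_null h2 h) (hUo.measure_ne_zero m
        (TopologicalSpace.nonempty_of_mem_countableBasis hU))
    · exact h
  have h2 := (ae_ball_iff (TopologicalSpace.countable_countableBasis Γ)).2 h1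
  have : NeBot (ae m) := ae_neBot.2 fun h => by
    have := isOpen_univ.measure_ne_zero m (univ_nonempty (α := Γ))
    simp [h] at this
  obtain ⟨x, hx⟩ := h2.exists
  refine ⟨x, (TopologicalSpace.isBasis_countableBasis Γ).dense_iff.2 fun U hU _ => ?_⟩
  rw [inter_comm]
  exact hx U hU

/-- If an iterate of an ergodic map is the identity near a point, then the images of a small
neighbourhood of the point form a saturated set that is neither null nor conull. -/
lemma IsErgodicFor.not_mem_nhds [TopologicalSpace Γ] [PolishSpace Γ] [BorelSpace Γ]
    [m.IsOpenPosMeasure] [m.OuterRegular] [NullSingletonClass m] (hT : InjOn T.toFun T.dom)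
    (hmeas : Measurable T.toFun) (hinv : T.IsInvariant m) (hm : T.IsErgodicFor m) {N : ℕ}
    (hN : 0 < N) {y : Γ} : {x | x ∈ T.iterDom N ∧ T.toFun^[N] x = x} ∉ 𝓝 y := by
  intro hy
  have huniv : m univ ≠ 0 := isOpen_univ.measure_ne_zero m ⟨y, trivial⟩
  have hN0 : (N : ENNReal) ≠ 0 := by exact_mod_cast hN.ne'
  obtain ⟨U, hyU, hUo, hU⟩ := Set.exists_isOpen_lt_of_lt (μ := m) {y} (m univ / N)
    (by
      rw [measure_singleton]
      exact ENNReal.div_pos huniv (ENNReal.natCast_ne_top N))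
  obtain ⟨V₀, hV₀, hV₀o, hyV₀⟩ := mem_nhds_iff.1 hy
  set V := U ∩ V₀ with hV
  have hVo : IsOpen V := hUo.inter hV₀o
  have hVdom (k : ℕ) (hk : k ≤ N) : V ⊆ T.iterDom k := fun x hx r hr =>
    (hV₀ hx.2).1 r (by omega)
  have himg (k : ℕ) (hk : k ≤ N) :
      MeasurableSet (T.toFun^[k] '' V) ∧ m (T.toFun^[k] '' V) = m V := by
    induction k with
    | zero => simpa using hVo.measurableSet
    | succ k ih =>
      have ih := ih (by omega)
      have h1 : T.toFun^[k + 1] '' V = T.toFun '' (T.toFun^[k] '' V) := by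
        rw [Function.iterate_succ', image_comp]
      have h2 : T.toFun^[k] '' V ⊆ T.dom := by
        rintro _ ⟨x, hx, rfl⟩
        exact hVdom (k + 1) hk hx k (by omega)
      rw [h1]
      exact ⟨ih.1.image_of_measurable_injOn hmeas (hT.mono h2), (hinv _ ih.1 h2).trans ih.2⟩
  set W := ⋃ k ∈ Finset.range N, T.toFun^[k] '' V with hW
  have hWmem {x : Γ} : x ∈ W ↔ ∃ k < N, ∃ v ∈ V, T.toFun^[k] v = x := by simp [hW]
  have hWmeas : MeasurableSet W := Finset.measurableSet_biUnion _ fun k hk =>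
    (himg k (Finset.mem_range.1 hk).le).1
  have hsat : T.IsSaturatedSet W := by
    intro x hx
    rw [hWmem, hWmem]
    constructor
    · rintro ⟨k, hk, v, hv, h⟩
      obtain ⟨r, hr, hr'⟩ : ∃ r < N, T.toFun^[r + 1] v = T.toFun x := by
        cases k with
        | zero => exact ⟨N - 1, by omega, by rw [Nat.sub_add_cancel hN, (hV₀ hv.2).2]; exact h⟩
        | succ k => exact ⟨k, by omega, h⟩
      rw [Function.iterate_succ_apply'] at hr'
      exact ⟨r, hr, v, hv, hT (hVdom N le_rfl hv r hr) hx hr'⟩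
    · rintro ⟨k, hk, v, hv, rfl⟩
      by_cases hk' : k + 1 < N
      · exact ⟨k + 1, hk', v, hv, Function.iterate_succ_apply' ..⟩
      · have : k + 1 = N := by omega
        refine ⟨0, hN, v, hv, ?_⟩
        rw [← Function.iterate_succ_apply' T.toFun k v, Nat.succ_eq_add_one, this, (hV₀ hv.2).2]
        rfl
  have hWle : m W < m univ := calc
    m W ≤ ∑ k ∈ Finset.range N, m (T.toFun^[k] '' V) := measure_biUnion_finset_le _ _
    _ = N * m V := by
      rw [Finset.sum_congr rfl fun k hk => (himg k (Finset.mem_range.1 hk).le).2]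
      simp
    _ ≤ N * m U := by gcongr; exact inter_subset_left
    _ < m univ := by
      rw [mul_comm]
      exact (ENNReal.lt_div_iff_mul_lt (.inl hN0) (.inl (ENNReal.natCast_ne_top N))).1 hU
  rcases hm W hWmeas hsat with h | h
  · refine hVo.measure_ne_zero m ⟨y, hyU rfl, hyV₀⟩ (measure_mono_null (fun x hx => ?_) h)
    exact hWmem.2 ⟨0, hN, x, hx, rfl⟩
  · refine hWle.not_ge ?_
    rw [← measure_add_measure_compl hWmeas, h, add_zero]

end Measure

/-- The criterion for minimality and unique ergodicity: it suffices to treat invariant measures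
without atoms and the orbits of points outside the domain, if iterates are locally the identity at
periodic points up to doubling the period. -/
theorem isMinimal_and_isUniquelyErgodic [MeasureSpace Γ] [TopologicalSpace Γ] [PolishSpace Γ]
    [BorelSpace Γ] [Nonempty Γ] [(volume : Measure Γ).IsOpenPosMeasure]
    [(volume : Measure Γ).OuterRegular] [NullSingletonClass (volume : Measure Γ)]
    [IsFiniteMeasure (volume : Measure Γ)] (hT : InjOn T.toFun T.dom)
    (hmeas : Measurable T.toFun) (hdom : MeasurableSet T.dom) (hinv : T.IsInvariant volume)
    (huniq : ∀ ν : Measure Γ, IsFiniteMeasure ν → NullSingletonClass ν →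
      T.IsInvariant ν → ∃ c : ENNReal, ν = c • volume)
    (hend : ∀ x ∉ T.dom, (T.orbit x).Infinite)
    (hper : ∀ n > 0, ∀ y ∈ T.iterDom n, T.toFun^[n] y = y →
      {x | x ∈ T.iterDom (2 * n) ∧ T.toFun^[2 * n] x = x} ∈ 𝓝 y) :
    T.IsMinimal ∧ T.IsUniquelyErgodic := by
  have herg := hinv.isErgodicFor huniq
  have horb := orbit_infinite hT hend fun n hn y hy hy' =>
    herg.not_mem_nhds hT hmeas hinv (by omega) (hper n hn y hy hy')
  exact ⟨⟨herg.isTransitive hT hmeas hdom, horb⟩, hinv, fun ν hν hνT =>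
    huniq ν hν (hνT.nullSingletonClass horb) hνT⟩

end PartialSelfMap


/-! ### The interval exchange transformation -/

section IntervalMap

open Set MeasureTheory Topology Filter

instance : (volume : Measure (Icc (0 : ℝ) 1)).IsOpenPosMeasure := by
  refine ⟨fun U hU hne h0 => ?_⟩
  obtain ⟨a, b, hab, hsub⟩ := hU.exists_Ioo_subset hne
  have h1 := measure_mono_null hsub h0
  rw [unitInterval.volume_Ioo, ENNReal.ofReal_eq_zero] at h1
  have : (a : ℝ) < b := hab
  linarith

/-- `E(l, tailStart)` reflects the `i`-th interval: it acts there as `x ↦ flipConst l i - x`. -/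
def flipConst (l : Fin 4 → ℝ) : Fin 4 → ℝ :=
  ![l 0 + l 1 + l 3, l 0 + l 1, 1 + l 0 + l 1, 1 + l 1]

/-- The formula for `E(l, tailStart)`, with irrelevant values at the cuts. -/
noncomputable def flipFun (l : Fin 4 → ℝ) (x : ℝ) : ℝ :=
  if x < l 0 then flipConst l 0 - x
  else if x < l 0 + l 1 then flipConst l 1 - x
  else if x < l 0 + l 1 + l 2 then flipConst l 2 - x
  else flipConst l 3 - x

/-- The interval exchange transformation `E(l, tailStart)` of `[0, 1]`. -/
noncomputable def intervalMap (l : Fin 4 → ℝ) : PartialSelfMap (Icc (0 : ℝ) 1) where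
  toFun x := projIcc 0 1 zero_le_one (flipFun l x)
  dom := {x | (x : ℝ) ≠ l 0 ∧ (x : ℝ) ≠ l 0 + l 1 ∧ (x : ℝ) ≠ l 0 + l 1 + l 2}

/-- The intervals of `intervalMap`, open in `[0, 1]`. -/
def piece (l : Fin 4 → ℝ) : Fin 4 → Set (Icc (0 : ℝ) 1) :=
  ![{x | (x : ℝ) < l 0}, {x | l 0 < (x : ℝ) ∧ (x : ℝ) < l 0 + l 1},
    {x | l 0 + l 1 < (x : ℝ) ∧ (x : ℝ) < l 0 + l 1 + l 2}, {x | l 0 + l 1 + l 2 < (x : ℝ)}]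

variable {l : Fin 4 → ℝ}

lemma intervalMap_dom (hl : ∀ i, 0 < l i) : (intervalMap l).dom = ⋃ i, piece l i := by
  ext x
  have h0 := hl 0
  have h1 := hl 1
  have h2 := hl 2
  simp only [mem_iUnion]
  constructor
  · rintro ⟨a, b, c⟩
    rcases lt_or_gt_of_ne a with a | a
    · exact ⟨0, a⟩
    rcases lt_or_gt_of_ne b with b | b
    · exact ⟨1, a, b⟩
    rcases lt_or_gt_of_ne c with c | c
    · exact ⟨2, b, c⟩
    · exact ⟨3, c⟩
  · rintro ⟨i, hi⟩
    fin_cases i <;> simp [piece] at hi <;> refine ⟨?_, ?_, ?_⟩ <;> intro h <;> linarith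

lemma coe_intervalMap (hl : ∀ i, 0 < l i) (hsum : ∑ i, l i = 1) {i : Fin 4} {x : Icc (0 : ℝ) 1}
    (hx : x ∈ piece l i) : ((intervalMap l).toFun x : ℝ) = flipConst l i - x := by
  have h0 := hl 0
  have h1 := hl 1
  have h2 := hl 2
  have h3 := hl 3
  obtain ⟨hx0, hx1⟩ := x.2
  rw [Fin.sum_univ_four] at hsum
  have key : flipFun l x = flipConst l i - x ∧ flipFun l x ∈ Icc (0 : ℝ) 1 := by
    fin_cases i <;> simp [piece] at hx <;> unfold flipFun <;> split_ifs <;>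
      simp [flipConst] at * <;> (try constructor) <;> (try constructor) <;> linarith
  simp only [intervalMap]
  rw [projIcc_of_mem _ key.2]
  exact key.1

lemma piece_subset_dom (hl : ∀ i, 0 < l i) (i : Fin 4) : piece l i ⊆ (intervalMap l).dom := by
  rw [intervalMap_dom hl]
  exact subset_iUnion _ i

lemma exists_mem_piece (hl : ∀ i, 0 < l i) {x : Icc (0 : ℝ) 1} (hx : x ∈ (intervalMap l).dom) :
    ∃ i, x ∈ piece l i := by
  rwa [intervalMap_dom hl, mem_iUnion] at hx

lemma isOpen_piece (i : Fin 4) : IsOpen (piece l i) := by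
  have hc : Continuous fun x : Icc (0 : ℝ) 1 => (x : ℝ) := continuous_subtype_val
  fin_cases i
  · exact isOpen_lt hc continuous_const
  · exact (isOpen_lt continuous_const hc).inter (isOpen_lt hc continuous_const)
  · exact (isOpen_lt continuous_const hc).inter (isOpen_lt hc continuous_const)
  · exact isOpen_lt continuous_const hc

lemma measurable_intervalMap : Measurable (intervalMap l).toFun := by
  have hc : Measurable fun x : Icc (0 : ℝ) 1 => (x : ℝ) := measurable_subtype_coe
  have hf : Measurable fun x : Icc (0 : ℝ) 1 => flipFun l x := by
    unfold flipFun
    exact .ite (measurableSet_lt hc measurable_const) (measurable_const.sub hc) (.ite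
      (measurableSet_lt hc measurable_const) (measurable_const.sub hc) (.ite
      (measurableSet_lt hc measurable_const) (measurable_const.sub hc) (measurable_const.sub hc)))
  exact (continuous_projIcc (h := zero_le_one)).measurable.comp hf

lemma injOn_intervalMap (hl : ∀ i, 0 < l i) (hsum : ∑ i, l i = 1) :
    InjOn (intervalMap l).toFun (intervalMap l).dom := by
  intro x hx y hy hxy
  obtain ⟨i, hi⟩ := exists_mem_piece hl hx
  obtain ⟨j, hj⟩ := exists_mem_piece hl hy
  have h : flipConst l i - x = flipConst l j - y := by
    rw [← coe_intervalMap hl hsum hi, ← coe_intervalMap hl hsum hj, hxy]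
  rw [Fin.sum_univ_four] at hsum
  have h0 := hl 0
  have h1 := hl 1
  have h2 := hl 2
  have h3 := hl 3
  obtain ⟨hx0, hx1⟩ := x.2
  obtain ⟨hy0, hy1⟩ := y.2
  refine Subtype.ext ?_
  clear hxy hx hy
  fin_cases i <;> fin_cases j <;> simp [piece, flipConst] at hi hj h <;> linarith

lemma disjoint_piece (hl : ∀ i, 0 < l i) (i j : Fin 4) (hij : i ≠ j) :
    Disjoint (piece l i) (piece l j) := by
  have h1 := hl 1
  have h2 := hl 2
  refine disjoint_left.2 fun x hi hj => hij ?_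
  fin_cases i <;> fin_cases j <;> simp [piece] at hi hj ⊢ <;> linarith

/-- The image of `intervalMap` avoids the end points. -/
lemma coe_intervalMap_mem_Ioo (hl : ∀ i, 0 < l i) (hsum : ∑ i, l i = 1) {x : Icc (0 : ℝ) 1}
    (hx : x ∈ (intervalMap l).dom) : ((intervalMap l).toFun x : ℝ) ∈ Ioo (0 : ℝ) 1 := by
  obtain ⟨i, hi⟩ := exists_mem_piece hl hx
  rw [coe_intervalMap hl hsum hi]
  rw [Fin.sum_univ_four] at hsum
  have h0 := hl 0
  have h1 := hl 1
  have h2 := hl 2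
  have h3 := hl 3
  obtain ⟨hx0, hx1⟩ := x.2
  fin_cases i <;> simp [piece, flipConst] at hi ⊢ <;> constructor <;> linarith

lemma leftEnd_fin_four : leftEnd l = ![0, l 0, l 0 + l 1, l 0 + l 1 + l 2] := by
  funext i
  fin_cases i <;> simp [leftEnd, Finset.sum_filter, Fin.sum_univ_four]

lemma branch_tailStart (hsum : ∑ i, l i = 1) (i : Fin 4) (x : ℝ) :
    branch l tailStart i x = flipConst l i - x := by
  rw [Fin.sum_univ_four] at hsum
  fin_cases i <;>
    simp [branch, leftEnd, imageLeftEnd, tailStart, flipConst, Finset.sum_filter,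
      Fin.sum_univ_four] <;> linarith

lemma mem_piece_of_mem_Ioo {i : Fin 4} {x : Icc (0 : ℝ) 1}
    (hx : (x : ℝ) ∈ Ioo (leftEnd l i) (rightEnd l i)) : x ∈ piece l i := by
  obtain ⟨h1, h2⟩ := hx
  fin_cases i <;>
    simp [rightEnd, leftEnd_fin_four, piece] at h1 h2 ⊢ <;>
    (try constructor) <;> assumption

lemma Icc_leftEnd_rightEnd_subset (hl : ∀ i, 0 < l i) (hsum : ∑ i, l i = 1) (i : Fin 4) :
    Icc (leftEnd l i) (rightEnd l i) ⊆ Icc 0 1 := by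
  have h0 := hl 0
  have h1 := hl 1
  have h2 := hl 2
  have h3 := hl 3
  rw [Fin.sum_univ_four] at hsum
  refine Icc_subset_Icc ?_ ?_ <;> fin_cases i <;>
    simp [rightEnd, leftEnd_fin_four] <;> linarith

lemma isSaturated_image_coe (hl : ∀ i, 0 < l i) (hsum : ∑ i, l i = 1) {O : Set (Icc (0 : ℝ) 1)}
    (hO : (intervalMap l).IsSaturatedSet O) :
    IsSaturated ((fun x : Icc (0 : ℝ) 1 => (x : ℝ)) '' O) l tailStart := by
  intro i x hx
  obtain ⟨X, rfl⟩ : ∃ X : Icc (0 : ℝ) 1, (X : ℝ) = x :=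
    ⟨⟨x, Icc_leftEnd_rightEnd_subset hl hsum i (Ioo_subset_Icc_self hx)⟩, rfl⟩
  have hX := mem_piece_of_mem_Ioo hx
  rw [branch_tailStart hsum, ← coe_intervalMap hl hsum hX,
    Subtype.val_injective.mem_set_image, Subtype.val_injective.mem_set_image]
  exact hO X (piece_subset_dom hl i hX)

lemma infinite_orbit_of_notMem_dom (hrig : IsRigid l tailStart) {x : Icc (0 : ℝ) 1}
    (hx : x ∉ (intervalMap l).dom) : ((intervalMap l).orbit x).Infinite := by
  have hinj := injOn_intervalMap hrig.pos hrig.sum_eq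
  refine Infinite.of_image (fun x : Icc (0 : ℝ) 1 => (x : ℝ)) (hrig.infinite _
    (isSaturated_image_coe hrig.pos hrig.sum_eq
      (PartialSelfMap.isSaturatedSet_orbit hinj x)) ?_)
  have hmem : x ∈ (intervalMap l).orbit x := ⟨0, .inl ⟨fun k hk => absurd hk (by omega), rfl⟩⟩
  have h1 : (x : ℝ) = leftEnd l 1 ∨ (x : ℝ) = leftEnd l 2 ∨ (x : ℝ) = leftEnd l 3 := by
    simp only [intervalMap, mem_ofPred_eq, not_and_or, not_not] at hx
    simpa [leftEnd_fin_four] using hx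
  rcases h1 with h | h | h
  · exact ⟨1, by decide, x, hmem, h⟩
  · exact ⟨2, by decide, x, hmem, h⟩
  · exact ⟨3, by decide, x, hmem, h⟩

/-! ### Measures invariant under the interval exchange transformation -/

/-- `intervalMap` maps an open interval contained in one of the pieces onto its reflection. -/
lemma image_intervalMap (hl : ∀ i, 0 < l i) (hsum : ∑ i, l i = 1) {i : Fin 4} {u v : ℝ}
    (hu : leftEnd l i ≤ u) (hv : v ≤ rightEnd l i) :
    (intervalMap l).toFun '' {y : Icc (0 : ℝ) 1 | u < (y : ℝ) ∧ (y : ℝ) < v} =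
      {y : Icc (0 : ℝ) 1 | flipConst l i - v < (y : ℝ) ∧ (y : ℝ) < flipConst l i - u} := by
  have hp {y : Icc (0 : ℝ) 1} (h1 : u < y) (h2 : (y : ℝ) < v) : y ∈ piece l i :=
    mem_piece_of_mem_Ioo ⟨hu.trans_lt h1, h2.trans_le hv⟩
  ext z
  constructor
  · rintro ⟨y, ⟨h1, h2⟩, rfl⟩
    simp only [mem_ofPred_eq]
    rw [coe_intervalMap hl hsum (hp h1 h2)]
    constructor <;> linarith
  · rintro ⟨h1, h2⟩
    have hmem : flipConst l i - z ∈ Icc (0 : ℝ) 1 :=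
      Icc_leftEnd_rightEnd_subset hl hsum i ⟨by linarith, by linarith⟩
    have h3 : u < ((⟨flipConst l i - z, hmem⟩ : Icc (0 : ℝ) 1) : ℝ) := by
      simp only
      linarith
    have h4 : ((⟨flipConst l i - z, hmem⟩ : Icc (0 : ℝ) 1) : ℝ) < v := by
      simp only
      linarith
    refine ⟨⟨_, hmem⟩, ⟨h3, h4⟩, Subtype.ext ?_⟩
    rw [coe_intervalMap hl hsum (hp h3 h4)]
    simp only
    ring

/-- The distribution function of a measure without atoms that is invariant under `intervalMap` is
equivariant; by rigidity it is affine, so the measure is a multiple of Lebesgue measure. -/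
lemma exists_eq_smul_volume (hrig : IsRigid l tailStart) {ν : Measure (Icc (0 : ℝ) 1)}
    [IsFiniteMeasure ν] [NullSingletonClass ν] (hν : (intervalMap l).IsInvariant ν) :
    ∃ c : ENNReal, ν = c • volume := by
  have hl := hrig.pos
  have hsum := hrig.sum_eq
  have hc : Measurable fun x : Icc (0 : ℝ) 1 => (x : ℝ) := measurable_subtype_coe
  have hmeas (u v : ℝ) : MeasurableSet {y : Icc (0 : ℝ) 1 | u < (y : ℝ) ∧ (y : ℝ) < v} :=
    (measurableSet_lt measurable_const hc).inter (measurableSet_lt hc measurable_const)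
  set F : ℝ → ℝ := fun x => ν.real {y : Icc (0 : ℝ) 1 | (y : ℝ) ≤ x} with hF
  have hmono : Monotone F := fun x x' h => measureReal_mono fun y hy => le_trans hy h
  have hdiff {u v : ℝ} (huv : u ≤ v) :
      F v - F u = ν.real {y : Icc (0 : ℝ) 1 | u < (y : ℝ) ∧ (y : ℝ) < v} := by
    have h1 : {y : Icc (0 : ℝ) 1 | (y : ℝ) ≤ v} =
        {y : Icc (0 : ℝ) 1 | (y : ℝ) ≤ u} ∪ {y : Icc (0 : ℝ) 1 | u < (y : ℝ) ∧ (y : ℝ) ≤ v} := by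
      ext y
      simp only [mem_union, mem_ofPred_eq]
      constructor
      · intro h
        rcases le_or_gt (y : ℝ) u with h' | h'
        · exact .inl h'
        · exact .inr ⟨h', h⟩
      · rintro (h | h)
        · exact h.trans huv
        · exact h.2
    have h2 : {y : Icc (0 : ℝ) 1 | u < (y : ℝ) ∧ (y : ℝ) ≤ v} =ᵐ[ν]
        {y : Icc (0 : ℝ) 1 | u < (y : ℝ) ∧ (y : ℝ) < v} := by
      have h3 : ν {y : Icc (0 : ℝ) 1 | (y : ℝ) = v} = 0 :=
        Set.Subsingleton.measure_zero (fun a ha b hb => Subtype.ext (ha.trans hb.symm)) ν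
      have h4 : ∀ᵐ y : Icc (0 : ℝ) 1 ∂ν, (y : ℝ) ≠ v := by
        rw [ae_iff]
        simpa using h3
      filter_upwards [h4] with y hy
      exact propext ⟨fun h => ⟨h.1, lt_of_le_of_ne h.2 hy⟩, fun h => ⟨h.1, h.2.le⟩⟩
    simp only [hF]
    rw [h1, measureReal_union, measureReal_congr h2]
    · ring
    · exact disjoint_left.2 fun y hy hy' => not_lt.2 hy hy'.1
    · exact (measurableSet_lt measurable_const hc).inter (measurableSet_le hc measurable_const)
  have hinv (i : Fin 4) {u v : ℝ} (huv : u ≤ v) (hu : leftEnd l i ≤ u) (hv : v ≤ rightEnd l i) :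
      F (flipConst l i - u) - F (flipConst l i - v) = F v - F u := by
    rw [hdiff (by linarith), hdiff huv, ← image_intervalMap hl hsum hu hv, measureReal_def,
      measureReal_def, hν _ (hmeas u v)]
    exact fun y hy => piece_subset_dom hl i
      (mem_piece_of_mem_Ioo ⟨hu.trans_lt hy.1, hy.2.trans_le hv⟩)
  have hequiv : IsEquivariant F l tailStart := by
    intro i u hu v hv
    rw [branch_tailStart hsum, branch_tailStart hsum,
      if_neg (by fin_cases i <;> simp [tailStart])]
    rcases le_total u v with huv | huv
    · linarith [hinv i huv hu.1 hv.2]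
    · exact hinv i huv hv.1 hu.2
  obtain ⟨c, hc⟩ := hrig.exists_eq_add_mul F hmono hequiv
  have hF0 : F 0 = 0 := by
    simp only [hF, measureReal_def]
    rw [Set.Subsingleton.measure_zero, ENNReal.toReal_zero]
    intro a ha b hb
    exact Subtype.ext ((le_antisymm ha a.2.1).trans (le_antisymm hb b.2.1).symm)
  have hc0 : 0 ≤ c := by
    have h1 := hmono (zero_le_one (α := ℝ))
    rw [hc 1 ⟨zero_le_one, le_rfl⟩] at h1
    linarith
  refine ⟨ENNReal.ofReal c, Measure.ext_of_Iic _ _ fun a => ?_⟩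
  rw [Measure.smul_apply, smul_eq_mul]
  erw [unitInterval.volume_Iic]
  rw [← ENNReal.ofReal_mul hc0]
  have h1 := hc a a.2
  rw [hF0, zero_add] at h1
  rw [← h1]
  exact (ofReal_measureReal (measure_ne_top ν _)).symm

lemma isInvariant_volume_intervalMap (hl : ∀ i, 0 < l i) (hsum : ∑ i, l i = 1) :
    (intervalMap l).IsInvariant volume := by
  refine PartialSelfMap.isInvariant_of_iUnion (injOn_intervalMap hl hsum) measurable_intervalMap
    (fun i => (isOpen_piece i).measurableSet) (disjoint_piece hl) (intervalMap_dom hl)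
    fun i A hA hAm => ?_
  have hB : MeasurableSet ((fun x : Icc (0 : ℝ) 1 => (x : ℝ)) '' A) :=
    (MeasurableEmbedding.subtype_coe measurableSet_Icc).measurableSet_image.2 hAm
  rw [← volume_image_subtype_coe measurableSet_Icc, ← volume_image_subtype_coe measurableSet_Icc,
    ← (Measure.measurePreserving_sub_left volume (flipConst l i)).measure_preimage
      hB.nullMeasurableSet]
  congr 1
  ext z
  constructor
  · rintro ⟨_, ⟨x, hx, rfl⟩, rfl⟩
    exact ⟨x, hx, by simp only; rw [coe_intervalMap hl hsum (hA hx)]; ring⟩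
  · rintro ⟨x, hx, h⟩
    exact ⟨_, ⟨x, hx, rfl⟩, by simp only at h; rw [coe_intervalMap hl hsum (hA hx), h]; ring⟩

/-- Near a point of the domain of its `n`-th iterate, that iterate is a translation or a
reflection. -/
lemma eventually_iterate (hl : ∀ i, 0 < l i) (hsum : ∑ i, l i = 1) {n : ℕ} {y : Icc (0 : ℝ) 1}
    (hy : y ∈ (intervalMap l).iterDom n) : ∀ᶠ x : Icc (0 : ℝ) 1 in 𝓝 y,
      x ∈ (intervalMap l).iterDom n ∧ ((intervalMap l).toFun^[n] x : ℝ) =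
        (intervalMap l).toFun^[n] y + (-1) ^ n * ((x : ℝ) - y) := by
  induction n with
  | zero => exact .of_forall fun x => ⟨fun k hk => absurd hk (by omega), by simp⟩
  | succ n ih =>
    obtain ⟨h1, h2⟩ := PartialSelfMap.mem_iterDom_succ'.1 hy
    obtain ⟨i, hi⟩ := exists_mem_piece hl h2
    have hn := ih h1
    have hcont : Tendsto (intervalMap l).toFun^[n] (𝓝 y) (𝓝 ((intervalMap l).toFun^[n] y)) := by
      rw [tendsto_subtype_rng]
      have h3 : Tendsto (fun x : Icc (0 : ℝ) 1 => ((intervalMap l).toFun^[n] y : ℝ) +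
          (-1) ^ n * ((x : ℝ) - y)) (𝓝 y) (𝓝 (((intervalMap l).toFun^[n] y : ℝ) +
          (-1) ^ n * ((y : ℝ) - y))) := Continuous.tendsto (by fun_prop) y
      rw [sub_self, mul_zero, add_zero] at h3
      exact h3.congr' (hn.mono fun x hx => hx.2.symm)
    filter_upwards [hn, hcont ((isOpen_piece i).mem_nhds hi)] with x hx hxi
    refine ⟨PartialSelfMap.mem_iterDom_succ'.2 ⟨hx.1, piece_subset_dom hl i hxi⟩, ?_⟩
    rw [Function.iterate_succ_apply', Function.iterate_succ_apply', coe_intervalMap hl hsum hxi,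
      coe_intervalMap hl hsum hi, hx.2]
    ring

theorem isMinimal_and_isUniquelyErgodic_intervalMap (hrig : IsRigid l tailStart) :
    (intervalMap l).IsMinimal ∧ (intervalMap l).IsUniquelyErgodic := by
  have hl := hrig.pos
  have hsum := hrig.sum_eq
  have hdom : MeasurableSet (intervalMap l).dom := by
    rw [intervalMap_dom hl]
    exact .iUnion fun i => (isOpen_piece i).measurableSet
  refine PartialSelfMap.isMinimal_and_isUniquelyErgodic (injOn_intervalMap hl hsum)
    measurable_intervalMap hdom (isInvariant_volume_intervalMap hl hsum)
    (fun ν _ _ hν => exists_eq_smul_volume hrig hν)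
    (fun x hx => infinite_orbit_of_notMem_dom hrig hx) fun n _ y hy hyy => ?_
  have h2 : y ∈ (intervalMap l).iterDom (2 * n) := by
    intro k hk
    rcases lt_or_ge k n with h | h
    · exact hy k h
    · rw [← Nat.sub_add_cancel h, Function.iterate_add_apply, hyy]
      exact hy _ (by omega)
  have h3 : (intervalMap l).toFun^[2 * n] y = y := by
    rw [two_mul, Function.iterate_add_apply, hyy, hyy]
  filter_upwards [eventually_iterate hl hsum h2] with x hx
  refine ⟨hx.1, Subtype.ext ?_⟩
  rw [hx.2, h3, pow_mul]
  simp

end IntervalMap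


/-! ### The axioms of an interval exchange transformation -/

section IntervalExchange

open Set Topology Filter

variable {l : Fin 4 → ℝ}

/-- Two functions that agree on a set agree at the points of its closure where they are
continuous. -/
lemma eq_of_mem_closure_of_eqOn {X Y : Type*} [TopologicalSpace X] [TopologicalSpace Y] [T2Space Y]
    {f g : X → Y} {I : Set X} {a : X} (ha : a ∈ closure I) (hf : ContinuousAt f a)
    (hg : ContinuousAt g a) (h : EqOn f g I) : f a = g a := by
  have := mem_closure_iff_nhdsWithin_neBot.1 ha
  refine tendsto_nhds_unique (f := f) (l := 𝓝[I] a) (hf.mono_left nhdsWithin_le_nhds) ?_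
  exact (hg.mono_left nhdsWithin_le_nhds).congr'
    (eventually_nhdsWithin_of_forall fun x hx => (h hx).symm)

lemma mem_closure_piece (hl : ∀ i, 0 < l i) (hsum : ∑ i, l i = 1) {i : Fin 4} {x : Icc (0 : ℝ) 1}
    (hx : (x : ℝ) ∈ Icc (leftEnd l i) (rightEnd l i)) : x ∈ closure (piece l i) := by
  have hlt : leftEnd l i < rightEnd l i := lt_add_of_pos_right _ (hl i)
  set A : Icc (0 : ℝ) 1 :=
    ⟨leftEnd l i, Icc_leftEnd_rightEnd_subset hl hsum i ⟨le_rfl, hlt.le⟩⟩ with hA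
  set B : Icc (0 : ℝ) 1 :=
    ⟨rightEnd l i, Icc_leftEnd_rightEnd_subset hl hsum i ⟨hlt.le, le_rfl⟩⟩ with hB
  have h1 : x ∈ closure (Ioo A B) := by
    rw [closure_Ioo (fun h => hlt.ne (congrArg Subtype.val h))]
    exact hx
  exact closure_mono (fun y hy => mem_piece_of_mem_Ioo hy) h1

lemma isMaximal_intervalMap (hl : ∀ i, 0 < l i) (hsum : ∑ i, l i = 1) :
    (intervalMap l).IsMaximal := by
  rintro U hU hlt ⟨g, hg, heq⟩
  obtain ⟨a, haU, ha⟩ := exists_of_ssubset hlt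
  have hga : ContinuousAt (fun x => (g x : ℝ)) a :=
    continuous_subtype_val.continuousAt.comp (hg.continuousAt (hU.mem_nhds haU))
  have key {i : Fin 4} (hi : (a : ℝ) ∈ Icc (leftEnd l i) (rightEnd l i)) :
      (g a : ℝ) = flipConst l i - a :=
    eq_of_mem_closure_of_eqOn (g := fun x : Icc (0 : ℝ) 1 => flipConst l i - (x : ℝ))
      (mem_closure_piece hl hsum hi) hga (Continuous.continuousAt (by fun_prop)) fun x hx => by
        simp only
        rw [heq (piece_subset_dom hl i hx), coe_intervalMap hl hsum hx]
  have h0 := hl 0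
  have h1 := hl 1
  have h2 := hl 2
  have h3 := hl 3
  rw [Fin.sum_univ_four] at hsum
  simp only [intervalMap, mem_ofPred_eq, not_and_or, not_not] at ha
  rcases ha with ha | ha | ha
  · have e1 := key (i := 0) (by
      simp [rightEnd, leftEnd_fin_four]; constructor <;> linarith)
    have e2 := key (i := 1) (by
      simp [rightEnd, leftEnd_fin_four]; constructor <;> linarith)
    simp [flipConst] at e1 e2
    linarith
  · have e1 := key (i := 1) (by
      simp [rightEnd, leftEnd_fin_four]; constructor <;> linarith)
    have e2 := key (i := 2) (by
      simp [rightEnd, leftEnd_fin_four]; constructor <;> linarith)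
    simp [flipConst] at e1 e2
    linarith
  · have e1 := key (i := 2) (by
      simp [rightEnd, leftEnd_fin_four]; constructor <;> linarith)
    have e2 := key (i := 3) (by
      simp [rightEnd, leftEnd_fin_four]; constructor <;> linarith)
    simp [flipConst] at e1 e2
    linarith

lemma ordConnected_piece (i : Fin 4) : (piece l i).OrdConnected := by
  refine ⟨fun x hx y hy z hz => ?_⟩
  have h1 : (x : ℝ) ≤ z := hz.1
  have h2 : (z : ℝ) ≤ y := hz.2
  fin_cases i <;> simp [piece] at hx hy ⊢ <;> (try constructor) <;> linarith

lemma nonempty_piece (hl : ∀ i, 0 < l i) (hsum : ∑ i, l i = 1) (i : Fin 4) :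
    (piece l i).Nonempty := by
  have h1 := hl i
  have hmem : leftEnd l i + l i / 2 ∈ Ioo (leftEnd l i) (rightEnd l i) := by
    rw [rightEnd]
    constructor <;> linarith
  exact ⟨⟨_, Icc_leftEnd_rightEnd_subset hl hsum i (Ioo_subset_Icc_self hmem)⟩,
    mem_piece_of_mem_Ioo hmem⟩

lemma dense_intervalMap_dom : Dense (intervalMap l).dom := by
  have h1 : {x : Icc (0 : ℝ) 1 | (x : ℝ) ∈ ({l 0, l 0 + l 1, l 0 + l 1 + l 2} : Set ℝ)}.Finite :=
    Set.Finite.preimage Subtype.val_injective.injOn (by simp)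
  refine (dense_univ.sdiff_finite h1).mono fun x hx => ?_
  simpa [intervalMap] using hx

lemma isIET_intervalMap (hl : ∀ i, 0 < l i) (hsum : ∑ i, l i = 1) : IsIET 4 4 (intervalMap l) := by
  have hflip (i : Fin 4) : StrictAntiOn (intervalMap l).toFun (piece l i) ∧
      ∀ x ∈ piece l i, ∀ y ∈ piece l i,
        dist ((intervalMap l).toFun x) ((intervalMap l).toFun y) = dist x y := by
    refine ⟨fun x hx y hy hxy => ?_, fun x hx y hy => ?_⟩
    · have h1 : (x : ℝ) < y := hxy
      rw [← Subtype.coe_lt_coe, coe_intervalMap hl hsum hx, coe_intervalMap hl hsum hy]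
      linarith
    · rw [Subtype.dist_eq, Subtype.dist_eq, coe_intervalMap hl hsum hx, coe_intervalMap hl hsum hy,
        dist_sub_left]
  refine ⟨le_rfl, zero_lt_one, piece l, fun i => ⟨isOpen_piece i, ordConnected_piece i,
    nonempty_piece hl hsum i⟩, disjoint_piece hl, intervalMap_dom hl, ?_,
    injOn_intervalMap hl hsum, fun i => .inr (hflip i), ?_, isMaximal_intervalMap hl hsum⟩
  · rw [← intervalMap_dom hl]
    exact dense_intervalMap_dom.closure_eq
  · rw [show {i | _} = (univ : Set (Fin 4)) from eq_univ_of_forall hflip, ncard_univ, Nat.card_fin]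

lemma hasCoordinates_intervalMap (hl : ∀ i, 0 < l i) (hsum : ∑ i, l i = 1) :
    HasCoordinates (intervalMap l) l tailStart := by
  refine ⟨hl, hsum, fun i x => ?_⟩
  intro left imageLeft h1 h2
  have hx := mem_piece_of_mem_Ioo (l := l) (i := i) ⟨h1, h2⟩
  exact ⟨piece_subset_dom hl i hx, by
    rw [coe_intervalMap hl hsum hx, ← branch_tailStart hsum]
    rfl⟩

end IntervalExchange


/-! ### The circle exchange transformation -/

section CircleMap

open Set MeasureTheory Topology Filter

/-- The representative in `[0, 1)` of a point of the circle, as a point of `[0, 1]`. -/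
noncomputable def circleRep (y : UnitAddCircle) : Icc (0 : ℝ) 1 :=
  ⟨AddCircle.equivIco 1 0 y, by
    obtain ⟨h1, h2⟩ := (AddCircle.equivIco 1 0 y).2
    exact ⟨h1, by linarith⟩⟩

lemma coe_circleRep (y : UnitAddCircle) :
    (((circleRep y : Icc (0 : ℝ) 1) : ℝ) : UnitAddCircle) = y :=
  AddCircle.coe_equivIco

lemma circleRep_coe {t : ℝ} (ht : t ∈ Ico (0 : ℝ) 1) :
    ((circleRep (t : UnitAddCircle) : Icc (0 : ℝ) 1) : ℝ) = t :=
  AddCircle.equivIco_coe_of_mem (by rwa [zero_add])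

lemma circleRep_mem_Ico (y : UnitAddCircle) : (circleRep y : ℝ) ∈ Ico (0 : ℝ) 1 := by
  obtain ⟨h1, h2⟩ := (AddCircle.equivIco 1 0 y).2
  exact ⟨h1, h2.trans_eq (zero_add 1)⟩

lemma circleRep_injective : Function.Injective circleRep := fun x y h => by
  rw [← coe_circleRep x, ← coe_circleRep y, h]

lemma measurable_circleRep : Measurable circleRep :=
  (measurable_subtype_coe.comp (AddCircle.measurableEquivIco 1 0).measurable).subtype_mk

/-- The constants of the three reflections of which `circleMap` consists. -/
def arcConst (l : Fin 4 → ℝ) : Fin 3 → ℝ := ![l 0 + l 1 + l 3, l 0 + l 1, 1 + l 1]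

/-- The left ends of the arcs exchanged by `circleMap`. -/
def arcLeft (l : Fin 4 → ℝ) : Fin 3 → ℝ := ![0, l 0, l 0 + l 1 + l 2]

/-- The right ends of the arcs exchanged by `circleMap`. -/
def arcRight (l : Fin 4 → ℝ) : Fin 3 → ℝ := ![l 0, l 0 + l 1 + l 2, 1]

/-- The arcs exchanged by `circleMap`. -/
def arc (l : Fin 4 → ℝ) (i : Fin 3) : Set UnitAddCircle :=
  (fun x : ℝ => (x : UnitAddCircle)) '' Ioo (arcLeft l i) (arcRight l i)

/-- The map of the circle that `intervalMap` induces. The second and the third interval merge: at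
the cut between them, the one-sided limits of `intervalMap` are `0` and `1`. -/
noncomputable def circleMap (l : Fin 4 → ℝ) : PartialSelfMap UnitAddCircle where
  toFun y :=
    if (circleRep y : ℝ) < l 0 then (arcConst l 0 : UnitAddCircle) - y
    else if (circleRep y : ℝ) < l 0 + l 1 + l 2 then (arcConst l 1 : UnitAddCircle) - y
    else (arcConst l 2 : UnitAddCircle) - y
  dom := ⋃ i, arc l i

variable {l : Fin 4 → ℝ}

lemma Ioo_arc_subset (hl : ∀ i, 0 < l i) (hsum : ∑ i, l i = 1) (i : Fin 3) :
    Ioo (arcLeft l i) (arcRight l i) ⊆ Ioo 0 1 := by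
  have h0 := hl 0
  have h1 := hl 1
  have h2 := hl 2
  have h3 := hl 3
  rw [Fin.sum_univ_four] at hsum
  refine Ioo_subset_Ioo ?_ ?_ <;> fin_cases i <;> simp [arcLeft, arcRight] <;> linarith

lemma arcLeft_lt_arcRight (hl : ∀ i, 0 < l i) (hsum : ∑ i, l i = 1) (i : Fin 3) :
    arcLeft l i < arcRight l i := by
  have h0 := hl 0
  have h1 := hl 1
  have h2 := hl 2
  have h3 := hl 3
  rw [Fin.sum_univ_four] at hsum
  fin_cases i <;> simp [arcLeft, arcRight] <;> linarith

lemma circleMap_coe (hl : ∀ i, 0 < l i) (hsum : ∑ i, l i = 1) {i : Fin 3} {t : ℝ}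
    (ht : t ∈ Ioo (arcLeft l i) (arcRight l i)) :
    (circleMap l).toFun t = ((arcConst l i - t : ℝ) : UnitAddCircle) := by
  have h01 := Ioo_arc_subset hl hsum i ht
  have h0 := hl 0
  have h1 := hl 1
  have h2 := hl 2
  obtain ⟨ht1, ht2⟩ := ht
  simp only [circleMap, circleRep_coe (Ioo_subset_Ico_self h01), AddCircle.coe_sub]
  fin_cases i <;> simp [arcLeft, arcRight] at ht1 ht2
  · rw [if_pos ht2]
    rfl
  · rw [if_neg (by linarith), if_pos ht2]
    rfl
  · rw [if_neg (by linarith), if_neg (by linarith)]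
    rfl

lemma circleMap_apply (hl : ∀ i, 0 < l i) (hsum : ∑ i, l i = 1) {i : Fin 3} {y : UnitAddCircle}
    (hy : y ∈ arc l i) : (circleMap l).toFun y = (arcConst l i : UnitAddCircle) - y := by
  obtain ⟨t, ht, rfl⟩ := hy
  simp only
  rw [circleMap_coe hl hsum ht, AddCircle.coe_sub]

lemma arc_subset_dom (i : Fin 3) : arc l i ⊆ (circleMap l).dom := subset_iUnion (arc l) i

/-- The circle map is induced by the interval map. -/
lemma isEndpointIdentification (hl : ∀ i, 0 < l i) (hsum : ∑ i, l i = 1) :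
    IsEndpointIdentification (intervalMap l) (circleMap l) := by
  intro x hx hx0 hx1
  obtain ⟨i, hi⟩ := exists_mem_piece hl hx
  rw [coe_intervalMap hl hsum hi]
  have h1 := hl 1
  have h2 := hl 2
  have key (j : Fin 3) (hj : (x : ℝ) ∈ Ioo (arcLeft l j) (arcRight l j))
      (hc : (arcConst l j : UnitAddCircle) = flipConst l i) :
      ((x : ℝ) : UnitAddCircle) ∈ (circleMap l).dom ∧
        (circleMap l).toFun ((x : ℝ) : UnitAddCircle) =
          ((flipConst l i - x : ℝ) : UnitAddCircle) := by
    refine ⟨arc_subset_dom j ⟨x, hj, rfl⟩, ?_⟩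
    rw [circleMap_coe hl hsum hj, AddCircle.coe_sub, AddCircle.coe_sub, hc]
  fin_cases i <;> simp [piece] at hi
  · exact key 0 ⟨hx0, hi⟩ rfl
  · exact key 1 ⟨hi.1, by simp [arcRight]; linarith⟩ rfl
  · refine key 1 ⟨by simp [arcLeft]; linarith, hi.2⟩ ?_
    simp only [arcConst, flipConst]
    change ((l 0 + l 1 : ℝ) : UnitAddCircle) = ((1 + l 0 + l 1 : ℝ) : UnitAddCircle)
    rw [add_assoc, AddCircle.coe_add, AddCircle.coe_add 1 1, AddCircle.coe_period, zero_add,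
      AddCircle.coe_add]
  · exact key 2 ⟨hi, hx1⟩ rfl

lemma injOn_circleMap (hl : ∀ i, 0 < l i) (hsum : ∑ i, l i = 1) :
    InjOn (circleMap l).toFun (circleMap l).dom := by
  intro x hx y hy hxy
  obtain ⟨i, s, hs, rfl⟩ := mem_iUnion.1 hx
  obtain ⟨j, t, ht, rfl⟩ := mem_iUnion.1 hy
  simp only at hxy
  rw [circleMap_coe hl hsum hs, circleMap_coe hl hsum ht] at hxy
  have h0 := hl 0
  have h1 := hl 1
  have h2 := hl 2
  have h3 := hl 3
  rw [Fin.sum_univ_four] at hsum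
  -- The lifts of the three images are disjoint intervals in a fundamental domain.
  have hdom {k : Fin 3} {r : ℝ} (hr : r ∈ Ioo (arcLeft l k) (arcRight l k)) :
      arcConst l k - r ∈ Ico (-l 2) (-l 2 + 1) := by
    obtain ⟨hr1, hr2⟩ := hr
    fin_cases k <;> simp [arcLeft, arcRight, arcConst] at hr1 hr2 ⊢ <;> constructor <;> linarith
  have h := (AddCircle.coe_eq_coe_iff_of_mem_Ico (hdom hs) (hdom ht)).1 hxy
  have hst : s = t := by
    obtain ⟨hs1, hs2⟩ := hs
    obtain ⟨ht1, ht2⟩ := ht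
    fin_cases i <;> fin_cases j <;> simp [arcLeft, arcRight, arcConst] at hs1 hs2 ht1 ht2 h <;>
      linarith
  rw [hst]

lemma disjoint_arc (hl : ∀ i, 0 < l i) (hsum : ∑ i, l i = 1) (i j : Fin 3) (hij : i ≠ j) :
    Disjoint (arc l i) (arc l j) := by
  refine disjoint_left.2 ?_
  rintro _ ⟨s, hs, rfl⟩ ⟨t, ht, hst⟩
  have hs' := Ioo_arc_subset hl hsum i hs
  have ht' := Ioo_arc_subset hl hsum j ht
  have hst' : t = s := by
    rw [← circleRep_coe (Ioo_subset_Ico_self ht'), ← circleRep_coe (Ioo_subset_Ico_self hs')]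
    exact congrArg _ (congrArg _ hst)
  subst hst'
  have h1 := hl 1
  have h2 := hl 2
  obtain ⟨hs1, hs2⟩ := hs
  obtain ⟨ht1, ht2⟩ := ht
  refine hij ?_
  fin_cases i <;> fin_cases j <;> simp [arcLeft, arcRight] at hs1 hs2 ht1 ht2 ⊢ <;> linarith

lemma coe_mem_closure_arc (hl : ∀ i, 0 < l i) (hsum : ∑ i, l i = 1) {i : Fin 3} {t : ℝ}
    (ht : t ∈ Icc (arcLeft l i) (arcRight l i)) : (t : UnitAddCircle) ∈ closure (arc l i) := by
  refine image_closure_subset_closure_image (AddCircle.continuous_mk' 1) ⟨t, ?_, rfl⟩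
  rwa [closure_Ioo (arcLeft_lt_arcRight hl hsum i).ne]

lemma exists_mem_Icc_arc {t : ℝ} (ht : t ∈ Icc (0 : ℝ) 1) :
    ∃ i, t ∈ Icc (arcLeft l i) (arcRight l i) := by
  rcases le_total t (l 0) with h | h
  · exact ⟨0, ht.1, h⟩
  rcases le_total t (l 0 + l 1 + l 2) with h' | h'
  · exact ⟨1, h, h'⟩
  · exact ⟨2, h', ht.2⟩

lemma closure_circleMap_dom (hl : ∀ i, 0 < l i) (hsum : ∑ i, l i = 1) :
    closure (circleMap l).dom = univ := by
  refine eq_univ_of_forall fun y => ?_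
  obtain ⟨i, hi⟩ := exists_mem_Icc_arc (l := l) (circleRep y).2
  have := coe_mem_closure_arc hl hsum hi
  rw [coe_circleRep] at this
  exact closure_mono (arc_subset_dom i) this

/-- A point outside the domain is an end point of an arc. -/
lemma circleRep_eq_of_notMem_dom {y : UnitAddCircle} (hy : y ∉ (circleMap l).dom) :
    (circleRep y : ℝ) = 0 ∨ (circleRep y : ℝ) = l 0 ∨ (circleRep y : ℝ) = l 0 + l 1 + l 2 := by
  by_contra! h
  obtain ⟨a, b, c⟩ := h
  obtain ⟨h0, h1⟩ := circleRep_mem_Ico y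
  refine hy (mem_iUnion.2 ?_)
  rcases lt_or_gt_of_ne b with b | b
  · exact ⟨0, _, ⟨lt_of_le_of_ne h0 a.symm, b⟩, coe_circleRep y⟩
  rcases lt_or_gt_of_ne c with c | c
  · exact ⟨1, _, ⟨b, c⟩, coe_circleRep y⟩
  · exact ⟨2, _, ⟨c, h1⟩, coe_circleRep y⟩

lemma isMaximal_circleMap (hl : ∀ i, 0 < l i) (hsum : ∑ i, l i = 1) :
    (circleMap l).IsMaximal := by
  rintro U hU hlt ⟨g, hg, heq⟩
  obtain ⟨a, haU, ha⟩ := exists_of_ssubset hlt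
  have key {i : Fin 3} {t : ℝ} (ht : t ∈ Icc (arcLeft l i) (arcRight l i))
      (hta : (t : UnitAddCircle) = a) : g a = (arcConst l i : UnitAddCircle) - a :=
    eq_of_mem_closure_of_eqOn (g := fun y => (arcConst l i : UnitAddCircle) - y)
      (hta ▸ coe_mem_closure_arc hl hsum ht) (hg.continuousAt (hU.mem_nhds haU))
      (Continuous.continuousAt (by fun_prop)) fun y hy =>
        (heq (arc_subset_dom i hy)).trans (circleMap_apply hl hsum hy)
  have hne {i j : Fin 3} {s t : ℝ} (hs : s ∈ Icc (arcLeft l i) (arcRight l i))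
      (ht : t ∈ Icc (arcLeft l j) (arcRight l j)) (hsa : (s : UnitAddCircle) = a)
      (hta : (t : UnitAddCircle) = a) {c d : ℝ} (hc : c ∈ Ico (0 : ℝ) (0 + 1))
      (hd : d ∈ Ico (0 : ℝ) (0 + 1)) (hci : (arcConst l i : UnitAddCircle) = c)
      (hdj : (arcConst l j : UnitAddCircle) = d) : c = d := by
    have h := sub_left_injective ((key hs hsa).symm.trans (key ht hta))
    rwa [hci, hdj, AddCircle.coe_eq_coe_iff_of_mem_Ico hc hd] at h
  have h0 := hl 0
  have h1 := hl 1
  have h2 := hl 2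
  have h3 := hl 3
  rw [Fin.sum_univ_four] at hsum
  have c2 : (arcConst l 2 : UnitAddCircle) = (l 1 : ℝ) := by
    change ((1 + l 1 : ℝ) : UnitAddCircle) = _
    rw [AddCircle.coe_add, AddCircle.coe_period, zero_add]
  have m0 : l 0 + l 1 + l 3 ∈ Ico (0 : ℝ) (0 + 1) := by constructor <;> linarith
  have m1 : l 0 + l 1 ∈ Ico (0 : ℝ) (0 + 1) := by constructor <;> linarith
  have m2 : l 1 ∈ Ico (0 : ℝ) (0 + 1) := by constructor <;> linarith
  have hrep := coe_circleRep a
  rcases circleRep_eq_of_notMem_dom ha with h | h | h <;> rw [h] at hrep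
  · have e1 : (1 : ℝ) ∈ Icc (arcLeft l 2) (arcRight l 2) := by
      simp [arcLeft, arcRight]
      linarith
    have h10 : ((1 : ℝ) : UnitAddCircle) = ((0 : ℝ) : UnitAddCircle) := AddCircle.coe_period 1
    have := hne (i := 0) ⟨le_rfl, h0.le⟩ e1 hrep (h10.trans hrep) m0 m2 rfl c2
    linarith
  · have e1 : l 0 ∈ Icc (arcLeft l 1) (arcRight l 1) := by
      simp [arcLeft, arcRight]
      linarith
    have := hne (i := 0) ⟨h0.le, le_rfl⟩ e1 hrep hrep m0 m1 rfl rfl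
    linarith
  · have e1 : l 0 + l 1 + l 2 ∈ Icc (arcLeft l 1) (arcRight l 1) := by
      simp [arcLeft, arcRight]
      linarith
    have e2 : l 0 + l 1 + l 2 ∈ Icc (arcLeft l 2) (arcRight l 2) := by
      simp [arcLeft, arcRight]
      linarith
    have := hne e1 e2 hrep hrep m1 m2 rfl c2
    linarith

lemma isCET_circleMap (hl : ∀ i, 0 < l i) (hsum : ∑ i, l i = 1) : IsCET 3 3 (circleMap l) := by
  have hflip (i : Fin 3) :
      ∃ c : UnitAddCircle, ∀ x ∈ arc l i, (circleMap l).toFun x = c - x :=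
    ⟨_, fun x hx => circleMap_apply hl hsum hx⟩
  refine ⟨arc l, fun i => ⟨arcLeft l i, arcRight l i, arcLeft_lt_arcRight hl hsum i, ?_, rfl⟩,
    disjoint_arc hl hsum, rfl, closure_circleMap_dom hl hsum, injOn_circleMap hl hsum,
    fun i => .inr (hflip i), ?_, isMaximal_circleMap hl hsum⟩
  · have h0 := hl 0
    have h1 := hl 1
    have h2 := hl 2
    have h3 := hl 3
    rw [Fin.sum_univ_four] at hsum
    fin_cases i <;> simp [arcLeft, arcRight] <;> linarith
  · rw [show {i | _} = (univ : Set (Fin 3)) from eq_univ_of_forall hflip, ncard_univ, Nat.card_fin]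

end CircleMap


/-! ### Minimality and unique ergodicity of the circle exchange transformation -/

section CircleDynamics

open Set MeasureTheory Topology Filter

variable {l : Fin 4 → ℝ}

/-- The quotient map from `[0, 1]` to the circle. -/
def toCircle (x : Icc (0 : ℝ) 1) : UnitAddCircle := ((x : ℝ) : UnitAddCircle)

lemma continuous_toCircle : Continuous toCircle :=
  (AddCircle.continuous_mk' 1).comp continuous_subtype_val

lemma toCircle_circleRep (y : UnitAddCircle) : toCircle (circleRep y) = y := coe_circleRep y

lemma circleRep_toCircle {x : Icc (0 : ℝ) 1} (hx : (x : ℝ) ∈ Ioo (0 : ℝ) 1) :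
    circleRep (toCircle x) = x :=
  Subtype.ext (circleRep_coe (Ioo_subset_Ico_self hx))

lemma iterate_circleMap (hl : ∀ i, 0 < l i) (hsum : ∑ i, l i = 1) {n : ℕ} {x : Icc (0 : ℝ) 1}
    (hx : (x : ℝ) ∈ Ioo (0 : ℝ) 1) (hn : x ∈ (intervalMap l).iterDom n) :
    toCircle x ∈ (circleMap l).iterDom n ∧
      (circleMap l).toFun^[n] (toCircle x) = toCircle ((intervalMap l).toFun^[n] x) := by
  induction n generalizing x with
  | zero => exact ⟨fun k hk => absurd hk (by omega), rfl⟩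
  | succ n ih =>
    obtain ⟨h1, h2⟩ := PartialSelfMap.mem_iterDom_succ.1 hn
    obtain ⟨h3, h4⟩ := isEndpointIdentification hl hsum x h1 hx.1 hx.2
    obtain ⟨h5, h6⟩ := ih (coe_intervalMap_mem_Ioo hl hsum h1) h2
    have h7 : (circleMap l).toFun (toCircle x) = toCircle ((intervalMap l).toFun x) := h4
    rw [← h7] at h5 h6
    exact ⟨PartialSelfMap.mem_iterDom_succ.2 ⟨h3, h5⟩, h6⟩

lemma toCircle_mem_orbit (hl : ∀ i, 0 < l i) (hsum : ∑ i, l i = 1) {x q : Icc (0 : ℝ) 1}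
    (hx : (x : ℝ) ∈ Ioo (0 : ℝ) 1) (hq : (q : ℝ) ∈ Ioo (0 : ℝ) 1)
    (h : q ∈ (intervalMap l).orbit x) : toCircle q ∈ (circleMap l).orbit (toCircle x) := by
  obtain ⟨n, ⟨h1, h2⟩ | ⟨h1, h2⟩⟩ := h
  · obtain ⟨h3, h4⟩ := iterate_circleMap hl hsum hx h1
    exact ⟨n, .inl ⟨h3, h4.trans (congrArg _ h2)⟩⟩
  · obtain ⟨h3, h4⟩ := iterate_circleMap hl hsum hq h1
    exact ⟨n, .inr ⟨h3, h4.trans (congrArg _ h2)⟩⟩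

lemma finite_compl_Ioo : {x : Icc (0 : ℝ) 1 | (x : ℝ) ∉ Ioo (0 : ℝ) 1}.Finite := by
  refine (Set.Finite.preimage Subtype.val_injective.injOn
    (by simp : ({0, 1} : Set ℝ).Finite)).subset fun x hx => ?_
  simp only [mem_ofPred_eq, mem_Ioo, not_and_or, not_lt] at hx
  rcases hx with hx | hx
  · exact .inl (le_antisymm hx x.2.1)
  · exact .inr (le_antisymm x.2.2 hx)

lemma infinite_orbit_toCircle (hrig : IsRigid l tailStart) {x : Icc (0 : ℝ) 1}
    (hx : (x : ℝ) ∈ Ioo (0 : ℝ) 1) : ((circleMap l).orbit (toCircle x)).Infinite := by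
  have h1 := ((isMinimal_and_isUniquelyErgodic_intervalMap hrig).1.2 x).sdiff finite_compl_Ioo
  have h2 : InjOn toCircle ((intervalMap l).orbit x \ {x | (x : ℝ) ∉ Ioo (0 : ℝ) 1}) := by
    rintro a ⟨-, ha⟩ b ⟨-, hb⟩ hab
    rw [← circleRep_toCircle (not_not.1 ha), hab, circleRep_toCircle (not_not.1 hb)]
  refine (h1.image h2).mono ?_
  rintro _ ⟨q, ⟨hq1, hq2⟩, rfl⟩
  exact toCircle_mem_orbit hrig.pos hrig.sum_eq hx (not_not.1 hq2) hq1

lemma infinite_orbit_circleMap (hrig : IsRigid l tailStart) (y : UnitAddCircle) :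
    ((circleMap l).orbit y).Infinite := by
  have hl := hrig.pos
  have hsum := hrig.sum_eq
  have h0 := hl 0
  have h1 := hl 1
  have h2 := hl 2
  have h3 := hl 3
  have hsum' := hsum
  rw [Fin.sum_univ_four] at hsum'
  obtain ⟨hy0, hy1⟩ := circleRep_mem_Ico y
  rcases hy0.eq_or_lt with h | h
  · -- The point `0` is the image of the cut at which two intervals merge.
    have hc : l 0 + l 1 ∈ Ioo (0 : ℝ) 1 := ⟨by linarith, by linarith⟩
    have harc : l 0 + l 1 ∈ Ioo (arcLeft l 1) (arcRight l 1) := by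
      simp [arcLeft, arcRight]
      constructor <;> linarith
    set x : Icc (0 : ℝ) 1 := ⟨l 0 + l 1, Ioo_subset_Icc_self hc⟩ with hx
    have h4 : (circleMap l).toFun (toCircle x) = y := by
      refine (circleMap_coe hl hsum harc).trans ?_
      rw [← coe_circleRep y, ← h]
      congr 1
      simp [arcConst]
    have hdom : toCircle x ∈ (circleMap l).dom := arc_subset_dom 1 ⟨_, harc, rfl⟩
    rw [← h4, PartialSelfMap.orbit_apply (injOn_circleMap hl hsum) hdom]
    exact infinite_orbit_toCircle hrig hc
  · rw [← toCircle_circleRep y]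
    exact infinite_orbit_toCircle hrig ⟨h, hy1⟩

lemma isTransitive_circleMap (hrig : IsRigid l tailStart) : (circleMap l).IsTransitive := by
  have hl := hrig.pos
  have hsum := hrig.sum_eq
  obtain ⟨p, hp⟩ := (isMinimal_and_isUniquelyErgodic_intervalMap hrig).1.1
  have hp' := hp.sdiff_finite finite_compl_Ioo
  obtain ⟨q, hqp, hq⟩ := hp'.nonempty
  have horb : (intervalMap l).orbit q = (intervalMap l).orbit p := by
    have hinj := injOn_intervalMap hl hsum
    rcases hqp with ⟨n, ⟨h1, rfl⟩ | ⟨h1, rfl⟩⟩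
    · exact PartialSelfMap.orbit_iterate hinj h1
    · exact (PartialSelfMap.orbit_iterate hinj h1).symm
  have hsurj : Function.Surjective toCircle := fun y => ⟨_, toCircle_circleRep y⟩
  refine ⟨toCircle q, (hsurj.denseRange.dense_image continuous_toCircle hp').mono ?_⟩
  rintro _ ⟨r, ⟨hr1, hr2⟩, rfl⟩
  rw [← horb] at hr1
  exact toCircle_mem_orbit hl hsum (not_not.1 hq) (not_not.1 hr2) hr1

lemma measurable_circleMap : Measurable (circleMap l).toFun := by
  have hr : Measurable fun y : UnitAddCircle => (circleRep y : ℝ) :=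
    measurable_subtype_coe.comp measurable_circleRep
  have hs (c : UnitAddCircle) : Measurable fun y : UnitAddCircle => c - y :=
    (continuous_const.sub continuous_id).measurable
  exact .ite (measurableSet_lt hr measurable_const) (hs _)
    (.ite (measurableSet_lt hr measurable_const) (hs _) (hs _))

lemma measurableSet_arc (hl : ∀ i, 0 < l i) (hsum : ∑ i, l i = 1) (i : Fin 3) :
    MeasurableSet (arc l i) := by
  have h1 : arc l i = (fun y => (circleRep y : ℝ)) ⁻¹' Ioo (arcLeft l i) (arcRight l i) := by
    ext y
    constructor
    · rintro ⟨t, ht, rfl⟩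
      rw [mem_preimage, circleRep_coe (Ioo_subset_Ico_self (Ioo_arc_subset hl hsum i ht))]
      exact ht
    · exact fun hy => ⟨_, hy, coe_circleRep y⟩
  rw [h1]
  exact (measurable_subtype_coe.comp measurable_circleRep) measurableSet_Ioo

lemma isInvariant_volume_circleMap (hl : ∀ i, 0 < l i) (hsum : ∑ i, l i = 1) :
    (circleMap l).IsInvariant volume := by
  refine PartialSelfMap.isInvariant_of_iUnion (injOn_circleMap hl hsum) measurable_circleMap
    (measurableSet_arc hl hsum) (disjoint_arc hl hsum) rfl fun i A hA hAm => ?_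
  rw [← (Measure.measurePreserving_sub_left volume
    (arcConst l i : UnitAddCircle)).measure_preimage hAm.nullMeasurableSet]
  congr 1
  ext z
  constructor
  · rintro ⟨x, hx, rfl⟩
    rw [mem_preimage, circleMap_apply hl hsum (hA hx), sub_sub_cancel]
    exact hx
  · intro hz
    exact ⟨_, hz, by rw [circleMap_apply hl hsum (hA hz), sub_sub_cancel]⟩

/-- An invariant measure of the circle map is, off the null point `0`, an invariant measure of the
interval map. -/
lemma isInvariant_map_circleRep (hl : ∀ i, 0 < l i) (hsum : ∑ i, l i = 1)
    {ν : Measure UnitAddCircle} [NullSingletonClass ν] (hν : (circleMap l).IsInvariant ν) :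
    (intervalMap l).IsInvariant (ν.map circleRep) := by
  intro A hA hAT
  have hinj := injOn_intervalMap hl hsum
  have hTA : MeasurableSet ((intervalMap l).toFun '' A) :=
    hA.image_of_measurable_injOn measurable_intervalMap (hinj.mono hAT)
  rw [Measure.map_apply measurable_circleRep hTA, Measure.map_apply measurable_circleRep hA]
  set E : Set (Icc (0 : ℝ) 1) := {x | (x : ℝ) ∉ Ioo (0 : ℝ) 1} with hE
  have hnull {C : Set (Icc (0 : ℝ) 1)} (hC : C.Finite) : ν (circleRep ⁻¹' C) = 0 :=
    (hC.preimage circleRep_injective.injOn).measure_zero ν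
  have hB : circleRep ⁻¹' (A \ E) ⊆ (circleMap l).dom := by
    rintro y ⟨hy, hyE⟩
    have h := isEndpointIdentification hl hsum _ (hAT hy) (not_not.1 hyE).1 (not_not.1 hyE).2
    rw [coe_circleRep] at h
    exact h.1
  have himg : (circleMap l).toFun '' (circleRep ⁻¹' (A \ E)) =
      circleRep ⁻¹' ((intervalMap l).toFun '' (A \ E)) := by
    have hstep {x : Icc (0 : ℝ) 1} (hx : x ∈ A \ E) : (circleMap l).toFun (toCircle x) =
        toCircle ((intervalMap l).toFun x) :=
      (isEndpointIdentification hl hsum _ (hAT hx.1) (not_not.1 hx.2).1 (not_not.1 hx.2).2).2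
    ext z
    constructor
    · rintro ⟨y, hy, rfl⟩
      refine ⟨circleRep y, hy, ?_⟩
      have h1 := hstep hy
      rw [toCircle_circleRep] at h1
      rw [h1, circleRep_toCircle (coe_intervalMap_mem_Ioo hl hsum (hAT hy.1))]
    · rintro ⟨x, hx, hxz⟩
      refine ⟨toCircle x, ?_, ?_⟩
      · rw [mem_preimage, circleRep_toCircle (not_not.1 hx.2)]
        exact hx
      · rw [hstep hx, hxz, toCircle_circleRep]
  have h1 : ν (circleRep ⁻¹' A) = ν (circleRep ⁻¹' (A \ E)) := by
    rw [preimage_sdiff, measure_sdiff_null (hnull finite_compl_Ioo)]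
  have h2 : ν (circleRep ⁻¹' ((intervalMap l).toFun '' A)) =
      ν (circleRep ⁻¹' ((intervalMap l).toFun '' (A \ E))) := by
    refine le_antisymm ?_ (measure_mono (preimage_mono (image_mono sdiff_subset)))
    have h3 : circleRep ⁻¹' ((intervalMap l).toFun '' A) ⊆
        circleRep ⁻¹' ((intervalMap l).toFun '' (A \ E)) ∪
          circleRep ⁻¹' ((intervalMap l).toFun '' E) := by
      rw [← preimage_union, ← image_union, sdiff_union_self]
      exact preimage_mono (image_mono subset_union_left)
    refine (measure_mono h3).trans ((measure_union_le _ _).trans ?_)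
    rw [hnull (finite_compl_Ioo.image _), add_zero]
  rw [h1, h2, ← himg]
  exact hν _ (measurable_circleRep (hA.diff finite_compl_Ioo.measurableSet)) hB

lemma exists_map_circleRep_eq (hrig : IsRigid l tailStart) {ν : Measure UnitAddCircle}
    [IsFiniteMeasure ν] [NullSingletonClass ν] (hν : (circleMap l).IsInvariant ν) :
    ∃ c : ENNReal, ν.map circleRep = c • volume := by
  have hfin : IsFiniteMeasure (ν.map circleRep) := Measure.isFiniteMeasure_map _ _
  have hnull : NullSingletonClass (ν.map circleRep) := ⟨fun x => by
    rw [Measure.map_apply measurable_circleRep (measurableSet_singleton x)]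
    exact ((subsingleton_singleton (a := x)).preimage circleRep_injective).measure_zero ν⟩
  exact exists_eq_smul_volume hrig (isInvariant_map_circleRep hrig.pos hrig.sum_eq hν)

theorem isMinimal_and_isUniquelyErgodic_circleMap (hrig : IsRigid l tailStart) :
    (circleMap l).IsMinimal ∧ (circleMap l).IsUniquelyErgodic := by
  have hl := hrig.pos
  have hsum := hrig.sum_eq
  have horb := infinite_orbit_circleMap hrig
  have hvol := isInvariant_volume_circleMap hl hsum
  refine ⟨⟨isTransitive_circleMap hrig, horb⟩, hvol, fun ν _ hν => ?_⟩
  have hback (ρ : Measure UnitAddCircle) : (ρ.map circleRep).map toCircle = ρ := by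
    rw [Measure.map_map continuous_toCircle.measurable measurable_circleRep,
      show toCircle ∘ circleRep = id from funext toCircle_circleRep, Measure.map_id]
  have hν0 := hν.nullSingletonClass horb
  have hvol0 := hvol.nullSingletonClass horb
  obtain ⟨c, hc⟩ := exists_map_circleRep_eq hrig hν
  obtain ⟨d, hd⟩ := exists_map_circleRep_eq hrig hvol
  have hd1 : d = 1 := by
    have h1 := congrArg (fun ρ : Measure (Icc (0 : ℝ) 1) => ρ univ) hd
    simp only [Measure.map_apply measurable_circleRep MeasurableSet.univ, preimage_univ,
      Measure.smul_apply, smul_eq_mul] at h1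
    rw [UnitAddCircle.measure_univ] at h1
    have h2 : (volume : Measure (Icc (0 : ℝ) 1)) univ = 1 :=
      (inferInstance : IsProbabilityMeasure (volume : Measure unitInterval)).measure_univ
    rw [h2, mul_one] at h1
    exact h1.symm
  rw [hd1, one_smul] at hd
  refine ⟨c, ?_⟩
  rw [← hback ν, hc, ← hd, Measure.map_smul, hback]

end CircleDynamics

end ExchangeMaps

open ExchangeMaps in
theorem mainTheorem4 :
    IsSpecialCycle cycleTypes cycleStart ∧
    IsRauzyPath tailTypes tailStart ∧
    pathEnd tailTypes tailStart = ![4, -3, 1, -2] ∧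
    pathEnd (cycleTypes.take 5) cycleStart = ![4, -3, 1, -2] ∧
    (∃ (σ : ℝ) (l μ : Fin 4 → ℝ),
      IsPerronFrobenius (pathMatrix cycleTypes cycleStart) σ l ∧
      μ = (toReal (pathMatrix tailTypes tailStart)).mulVec
            ((toReal (pathMatrix (cycleTypes.take 5) cycleStart))⁻¹.mulVec l) ∧
      ∃ T : PartialSelfMap (Set.Icc (0 : ℝ) 1),
        IsIET 4 4 T ∧
        HasCoordinates T ((∑ i, μ i)⁻¹ • μ) tailStart ∧
        T.IsMinimal ∧ T.IsUniquelyErgodic ∧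
        ∃ S : PartialSelfMap UnitAddCircle,
          IsCET 3 3 S ∧
          IsEndpointIdentification T S ∧
          S.IsMinimal ∧ S.IsUniquelyErgodic) ∧
    (transitiveIETs 4 4).Nonempty ∧
    (transitiveCETs 3 3).Nonempty := by
  obtain ⟨σ, hσ, hroot⟩ := exists_root
  set μ := (toReal (pathMatrix tailTypes tailStart)).mulVec
    ((toReal (pathMatrix (cycleTypes.take 5) cycleStart))⁻¹.mulVec (perronVec σ)) with hμ
  have hrig := isRigid_tail hσ hroot hμ
  have hIET := isIET_intervalMap hrig.pos hrig.sum_eq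
  have hCET := isCET_circleMap hrig.pos hrig.sum_eq
  obtain ⟨hTmin, hTerg⟩ := isMinimal_and_isUniquelyErgodic_intervalMap hrig
  obtain ⟨hSmin, hSerg⟩ := isMinimal_and_isUniquelyErgodic_circleMap hrig
  refine ⟨isSpecialCycle_cycle, isVerifiedPath_tail.isRauzyPath (by simp [tailTypes]),
    isVerifiedPath_tail.2.1, isVerifiedPath_take_cycle.2.1, ⟨σ, perronVec σ, μ, ?_, hμ, _, hIET,
      hasCoordinates_intervalMap hrig.pos hrig.sum_eq, hTmin, hTerg, _, hCET,
      isEndpointIdentification hrig.pos hrig.sum_eq, hSmin, hSerg⟩,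
    ⟨⟨(0, 1), _⟩, hIET, hTmin.1⟩, ⟨_, hCET, hSmin.1⟩⟩
  rw [isVerifiedPath_cycle.2.2.1]
  exact isPerronFrobenius_perronVec hσ hroot
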